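/- Let $d\ge 0$, $\hbar>0$, $m>0$, and let $V\in C^3(\mathbb R^d)$. Write $z=(q,p)\in\mathbb R^{2d}$, $\mathbb J=\begin{bmatrix}0&I_d\\-I_d&0\end{bmatrix}$, $\Omega_{\mathbb R^{2d}}(z_1,z_2)=z_1\cdot\mathbb J z_2$, and let $\mathsf{sym}(n,\mathbb R)$ be the space of real symmetric $n\times n$ matrices. Let $\mathbb H_d=\{\mathcal C=\mathcal A+\mathrm i\mathcal B:\mathcal A,\mathcal B\in\mathsf{sym}(d,\mathbb R),\ \mathcal B>0\}$, on which $\mathsf{Sp}(\mathbb R^{2d})$ acts by $\Phi_S(\mathcal C)=(S_{21}+S_{22}\mathcal C)(S_{11}+S_{12}\mathcal C)^{-1}$, and let $$\sigma(\mathcal C)=\begin{bmatrix}\mathcal B^{-1}&\mathcal B^{-1}\mathcal A\\ \mathcal A\mathcal B^{-1}&\mathcal A\mathcal B^{-1}\mathcal A+\mathcal B\end{bmatrix}.$$ Let $\mathcal P=\mathbb R^{2d}\times\mathbb H_d$ carry the symplectic form $\Omega=\Omega_{\mathbb R^{2d}}-\frac\hbar4\Omega_{\mathbb H_d}$, where $\Omega_{\mathbb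 H_d}=-\sum_{j,k}\mathbf d(\mathcal B^{-1})_{jk}\wedge\mathbf d\mathcal A_{jk}$, and the Poisson bracket $\{F,G\}_{\mathcal P}=\Omega(X_F,X_G)$, where $\Omega(X_F,\cdot)=\mathbf dF$. On $\mathsf{sym}(2d,\mathbb R)$ put $[\xi,\eta]=\xi\mathbb J^T\eta-\eta\mathbb J^T\xi$ and identify it with $\mathfrak{sp}(\mathbb R^{2d})$ by $\xi\mapsto\mathbb J^T\xi$; put $\mathrm{ad}^*_\xi\mu=\mathbb J\xi\mu-\mu\xi\mathbb J$ and $\mathrm{Ad}^*_{S^{-1}}\mu=S\mu S^T$. A coadjoint orbit $\mathcal O\subset\mathsf{sym}(2d,\mathbb R)$ has tangent spaces $T_\mu\mathcal O=\{\mathrm{ad}^*_\xi\mu\}$ and carries the form $\Omega^+_{\mathcal O}(\mu)(\mathrm{ad}^*_\xi\mu,\mathrm{ad}^*_\eta\mu)=\mathrm{tr}(\mu[\xi,\eta])$. On $\mathbb R^{2d}\times\mathsf{sym}(2d,\mathbb R)=\{(z,\Sigma)\}$ let $$\{f,g\}=\{f,g\}_{\mathbb R^{2d}}-\tfrac4\hbar\,\mathrm{tr}\bigl(\Sigma\,[\tfrac{\delta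 f}{\delta\Sigma},\tfrac{\delta g}{\delta\Sigma}]\bigr),$$ where $\{\cdot,\cdot\}_{\mathbb R^{2d}}$ is the canonical bracket in $(q,p)$ and $\delta f/\delta\Sigma$ is the gradient with respect to the inner product $\mathrm{tr}(\xi\eta)$. Let $\mathsf G=\mathbb R^{2d}\times\mathsf{Sp}(\mathbb R^{2d})$ (direct product). It acts on $\mathcal P$ by $\Psi_{(\delta z,S)}(z,\mathcal C)=(z+\mathbb J\delta z,\Phi_S(\mathcal C))$ and on $\mathbb R^{2d}\times\mathsf{sym}(2d,\mathbb R)$ by $(\delta z,S)\cdot(z,\Sigma)=(z+\mathbb J\delta z,\mathrm{Ad}^*_{S^{-1}}\Sigma)$. The dual of the Lie algebra $\mathbb R^{2d}\times\mathsf{sym}(2d,\mathbb R)$ of $\mathsf G$ is identified with $\mathbb R^{2d}\times\mathsf{sym}(2d,\mathbb R)$ by the pairing $\langle(z,\Sigma),(\delta z,\xi)\rangle=z\cdot\delta z-\frac\hbar4\mathrm{tr}(\Sigma\xi)$. Then: (i) The momentum map of $\Psi$ on $(\mathcal P,\Omega)$, that is, the smooth map $\mathbf M:\mathcal P\to\mathbb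 R^{2d}\times\mathsf{sym}(2d,\mathbb R)$, unique up to an additive constant, with $\Omega(a_{\mathcal P},\cdot)=\mathbf d\langle\mathbf M,a\rangle$ for every $a$ in the Lie algebra of $\mathsf G$ with infinitesimal generator $a_{\mathcal P}$, is $\mathbf M(z,\mathcal C)=(z,\sigma(\mathcal C))$, and $\mathbf M$ is equivariant for the two actions of $\mathsf G$ above. (ii) $\mathbf M$ is Poisson: $\{f\circ\mathbf M,g\circ\mathbf M\}_{\mathcal P}=\{f,g\}\circ\mathbf M$ for all $f,g\in C^\infty(\mathbb R^{2d}\times\mathsf{sym}(2d,\mathbb R))$. (iii) Let $\mathcal O$ be the coadjoint orbit that contains some $\sigma(\mathcal C)$, and let $\omega=\Omega_{\mathbb R^{2d}}-\frac\hbar4\Omega^+_{\mathcal O}$ on $\mathbb R^{2d}\times\mathcal O$. Then $\mathbf M$ maps $\mathcal P$ into $\mathbb R^{2d}\times\mathcal O$, and $\mathbf M^*\omega=\Omega$. (iv) Let $H=\frac{p^2}{2m}+V(q)+\frac\hbar4\mathrm{tr}\bigl[\mathcal B^{-1}\bigl(\frac{\mathcal A^2+\mathcal B^2}m+D^2V(q)\bigr)\bigr]$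 on $\mathcal P$, let $H_{\rm cl}(q,p)=\frac{p^2}{2m}+V(q)$, and let $\mathcal O_\Sigma$ be the coadjoint orbit through $\Sigma=\sigma(\mathcal C)$ for some $\mathcal C\in\mathbb H_d$. The equation $X_h\circ\mathbf M=T\mathbf M\circ X_H$ defines exactly one vector field $X_h$ on $\mathbb R^{2d}\times\mathcal O_\Sigma$. It is the Hamiltonian vector field, $\omega(X_h,\cdot)=\mathbf dh$, of $$h(z,\Sigma)=H_{\rm cl}(z)+\tfrac\hbar4\mathrm{tr}(\Sigma\,D^2H_{\rm cl}(z))=\frac{p^2}{2m}+V(q)+\frac\hbar4\,\mathrm{tr}\Bigl(\frac{\Sigma_{22}}m+\Sigma_{11}D^2V(q)\Bigr),$$ and it is given by $\dot z=\{z,h\}_{\mathbb R^{2d}}$, $\dot\Sigma=\frac4\hbar\,\mathrm{ad}^*_{\delta h/\delta\Sigma}\Sigma=\frac4\hbar\bigl(\mathbb J\frac{\delta h}{\delta\Sigma}\Sigma-\Sigma\frac{\delta h}{\delta\Sigma}\mathbb J\bigr)$, that is, $$\dot q=\frac pm,\qquad \dot p=-\frac{\partial}{\partial q}\Bigl[V(q)+\frac\hbar4\mathrm{tr}(\Sigma_{11}D^2V(q))\Bigr],\qquad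 \dot\Sigma=\mathbb J\,D^2H_{\rm cl}(z)\,\Sigma-\Sigma\,D^2H_{\rm cl}(z)\,\mathbb J .$$ -/

import Mathlib

open Matrix
open scoped ContDiff

attribute [local instance] Matrix.normedAddCommGroup Matrix.normedSpace

noncomputable section

namespace GWP

/-! ### Symmetric matrices, the matrix `𝕁`, the phase space -/

/-- The real vector space `sym(n, ℝ)` of symmetric real matrices. -/
def symSubmodule (n : Type) : Submodule ℝ (Matrix n n ℝ) where
  carrier := {A | Aᵀ = A}
  add_mem' {a b} ha hb := by
    simp only [Set.mem_ofPred_eq, transpose_add] at *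
    rw [ha, hb]
  zero_mem' := by simp
  smul_mem' c a ha := by
    simp only [Set.mem_ofPred_eq, transpose_smul] at *
    rw [ha]

abbrev Sym (n : Type) : Type := symSubmodule n

theorem Sym.transpose_eq {n : Type} (A : Sym n) : (A : Matrix n n ℝ)ᵀ = A := A.2

/-- `𝕁 = [[0, I], [-I, 0]]`. -/
def JJ (d : ℕ) : Matrix (Fin d ⊕ Fin d) (Fin d ⊕ Fin d) ℝ := fromBlocks 0 1 (-1) 0

theorem JJ_eq (d : ℕ) : JJ d = -Matrix.J (Fin d) ℝ := by
  rw [JJ, Matrix.J, fromBlocks_neg]; simp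

theorem JJ_transpose (d : ℕ) : (JJ d)ᵀ = -JJ d := by
  rw [JJ_eq]; simp

/-- `ℝ^{2d} = {z = (q, p)}`, with `q = z ∘ Sum.inl` and `p = z ∘ Sum.inr`. -/
abbrev PhaseSpace (d : ℕ) : Type := Fin d ⊕ Fin d → ℝ

/-- The Lie algebra / dual space `sym(2d, ℝ)`. -/
abbrev Sym2 (d : ℕ) : Type := Sym (Fin d ⊕ Fin d)

/-! ### The Siegel upper half space and `𝒫 = ℝ^{2d} × ℍ_d` -/

/-- The real vector space of pairs `(𝒜, ℬ)`, in which `ℍ_d` is an open subset. -/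
abbrev SiegelModel (d : ℕ) : Type := Sym (Fin d) × Sym (Fin d)

/-- The Siegel upper half space, `𝒞 = 𝒜 + iℬ` being recorded as the pair `(𝒜, ℬ)`. -/
def siegel (d : ℕ) : Set (SiegelModel d) := {c | (c.2 : Matrix (Fin d) (Fin d) ℝ).PosDef}

/-- The complex matrix `𝒞 = 𝒜 + iℬ`. -/
def toComplex {d : ℕ} (c : SiegelModel d) : Matrix (Fin d) (Fin d) ℂ :=
  (c.1 : Matrix (Fin d) (Fin d) ℝ).map Complex.ofReal +
    Complex.I • (c.2 : Matrix (Fin d) (Fin d) ℝ).map Complex.ofReal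

/-- The vector space that contains `𝒫` as an open subset; all its tangent spaces. -/
abbrev PModel (d : ℕ) : Type := PhaseSpace d × SiegelModel d

/-- `𝒫 = ℝ^{2d} × ℍ_d`. -/
def P (d : ℕ) : Set (PModel d) := {x | x.2 ∈ siegel d}

/-- The space `ℝ^{2d} × sym(2d, ℝ) = {(z, Σ)}` of Gaussian moments. -/
abbrev Moments (d : ℕ) : Type := PhaseSpace d × Sym2 d

/-! ### The action of the symplectic group on the Siegel upper half space -/

/-- `S₂₁ + S₂₂ 𝒞`. -/
def numer {d : ℕ} (S : Matrix (Fin d ⊕ Fin d) (Fin d ⊕ Fin d) ℝ) (c : SiegelModel d) :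
    Matrix (Fin d) (Fin d) ℂ :=
  S.toBlocks₂₁.map Complex.ofReal + S.toBlocks₂₂.map Complex.ofReal * toComplex c

/-- `S₁₁ + S₁₂ 𝒞`. -/
def denom {d : ℕ} (S : Matrix (Fin d ⊕ Fin d) (Fin d ⊕ Fin d) ℝ) (c : SiegelModel d) :
    Matrix (Fin d) (Fin d) ℂ :=
  S.toBlocks₁₁.map Complex.ofReal + S.toBlocks₁₂.map Complex.ofReal * toComplex c

/-- `(S₂₁ + S₂₂ 𝒞)(S₁₁ + S₁₂ 𝒞)⁻¹`. -/
def mobius {d : ℕ} (S : Matrix (Fin d ⊕ Fin d) (Fin d ⊕ Fin d) ℝ) (c : SiegelModel d) :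
    Matrix (Fin d) (Fin d) ℂ :=
  numer S c * (denom S c)⁻¹

theorem toComplex_transpose {d : ℕ} (c : SiegelModel d) : (toComplex c)ᵀ = toComplex c := by
  simp only [toComplex, transpose_add, transpose_smul, ← transpose_map, Sym.transpose_eq]

theorem toComplex_conjTranspose {d : ℕ} (c : SiegelModel d) :
    (toComplex c)ᴴ = (c.1 : Matrix (Fin d) (Fin d) ℝ).map Complex.ofReal -
      Complex.I • (c.2 : Matrix (Fin d) (Fin d) ℝ).map Complex.ofReal := by
  have h : (toComplex c)ᴴ = ((toComplex c)ᵀ).map star := rfl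
  rw [h, toComplex_transpose]
  ext i j
  simp [toComplex, sub_eq_add_neg]

/-- A real matrix has the same conjugate transpose as transpose. -/
theorem map_ofReal_conjTranspose {d : ℕ} (A : Matrix (Fin d) (Fin d) ℝ) :
    (A.map Complex.ofReal)ᴴ = Aᵀ.map Complex.ofReal := by
  ext i j; simp

theorem block_relations {d : ℕ} (S : Matrix.symplecticGroup (Fin d) ℝ) :
    S.1.toBlocks₁₁ᵀ * S.1.toBlocks₂₁ = S.1.toBlocks₂₁ᵀ * S.1.toBlocks₁₁ ∧
    S.1.toBlocks₁₂ᵀ * S.1.toBlocks₂₂ = S.1.toBlocks₂₂ᵀ * S.1.toBlocks₁₂ ∧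
    S.1.toBlocks₁₁ᵀ * S.1.toBlocks₂₂ - S.1.toBlocks₂₁ᵀ * S.1.toBlocks₁₂ = 1 := by
  rw [← SymplecticGroup.fromBlocks_mem_iff, fromBlocks_toBlocks]
  exact S.2

/-- For real blocks satisfying the symplectic relations,
`(a + D b)(c' + d' C) - (a' + D b')(…)` collapses to `C - D`. -/
theorem collapse {d : ℕ} (S : Matrix.symplecticGroup (Fin d) ℝ)
    (C D : Matrix (Fin d) (Fin d) ℂ) :
    (S.1.toBlocks₁₁ᵀ.map Complex.ofReal + D * S.1.toBlocks₁₂ᵀ.map Complex.ofReal) *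
        (S.1.toBlocks₂₁.map Complex.ofReal + S.1.toBlocks₂₂.map Complex.ofReal * C) -
      (S.1.toBlocks₂₁ᵀ.map Complex.ofReal + D * S.1.toBlocks₂₂ᵀ.map Complex.ofReal) *
        (S.1.toBlocks₁₁.map Complex.ofReal + S.1.toBlocks₁₂.map Complex.ofReal * C) =
      C - D := by
  obtain ⟨h1, h2, h3⟩ := block_relations S
  have h4 : S.1.toBlocks₂₂ᵀ * S.1.toBlocks₁₁ - S.1.toBlocks₁₂ᵀ * S.1.toBlocks₂₁ = 1 := by
    have := congrArg Matrix.transpose h3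
    simpa [transpose_sub, transpose_mul] using this
  have e : ∀ A B : Matrix (Fin d) (Fin d) ℝ, (A * B).map Complex.ofReal =
      A.map Complex.ofReal * B.map Complex.ofReal := fun A B =>
    Matrix.map_mul (f := Complex.ofRealHom)
  have es : ∀ A B : Matrix (Fin d) (Fin d) ℝ, (A - B).map Complex.ofReal =
      A.map Complex.ofReal - B.map Complex.ofReal := fun A B => by ext i j; simp
  have e1 : (1 : Matrix (Fin d) (Fin d) ℝ).map Complex.ofReal = 1 :=
    Matrix.map_one _ (by simp) (by simp)
  have g1 := congrArg (fun A => A.map Complex.ofReal) h1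
  have g2 := congrArg (fun A => A.map Complex.ofReal) h2
  have g3 := congrArg (fun A => A.map Complex.ofReal) h3
  have g4 := congrArg (fun A => A.map Complex.ofReal) h4
  simp only [e, es, e1] at g1 g2 g3 g4
  generalize S.1.toBlocks₁₁ᵀ.map Complex.ofReal = a at *
  generalize S.1.toBlocks₁₂ᵀ.map Complex.ofReal = b at *
  generalize S.1.toBlocks₂₁ᵀ.map Complex.ofReal = a' at *
  generalize S.1.toBlocks₂₂ᵀ.map Complex.ofReal = b' at *
  generalize S.1.toBlocks₁₁.map Complex.ofReal = p at *
  generalize S.1.toBlocks₁₂.map Complex.ofReal = q at *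
  generalize S.1.toBlocks₂₁.map Complex.ofReal = r at *
  generalize S.1.toBlocks₂₂.map Complex.ofReal = s at *
  have key : (a + D * b) * (r + s * C) - (a' + D * b') * (p + q * C) =
      (a * r - a' * p) + (a * s - a' * q) * C - D * (b' * p - b * r) +
        D * (b * s - b' * q) * C := by noncomm_ring
  rw [key, g1, g2, g3, g4]
  noncomm_ring

theorem denom_transpose {d : ℕ} (S : Matrix.symplecticGroup (Fin d) ℝ) (c : SiegelModel d) :
    (denom S.1 c)ᵀ * numer S.1 c = (numer S.1 c)ᵀ * denom S.1 c := by
  have h := collapse S (toComplex c) (toComplex c)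
  rw [sub_self, sub_eq_zero] at h
  simpa only [denom, numer, transpose_add, transpose_mul, toComplex_transpose,
    ← transpose_map] using h

theorem denom_conjTranspose {d : ℕ} (S : Matrix.symplecticGroup (Fin d) ℝ)
    (c : SiegelModel d) :
    (denom S.1 c)ᴴ * numer S.1 c - (numer S.1 c)ᴴ * denom S.1 c =
      (2 * Complex.I) • (c.2 : Matrix (Fin d) (Fin d) ℝ).map Complex.ofReal := by
  have h := collapse S (toComplex c) ((toComplex c)ᴴ)
  simp only [denom, numer, conjTranspose_add, conjTranspose_mul, map_ofReal_conjTranspose]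
  rw [h, toComplex_conjTranspose, toComplex, two_mul, add_smul]
  abel

theorem quad_pos {d : ℕ} {B : Matrix (Fin d) (Fin d) ℝ} (hB : B.PosDef) {v : Fin d → ℂ}
    (hv : v ≠ 0) : 0 < (star v ⬝ᵥ (B.map Complex.ofReal *ᵥ v)).re := by
  have key : (star v ⬝ᵥ (B.map Complex.ofReal *ᵥ v)).re =
      (fun i => (v i).re) ⬝ᵥ (B *ᵥ fun i => (v i).re) +
        (fun i => (v i).im) ⬝ᵥ (B *ᵥ fun i => (v i).im) := by
    simp only [dotProduct, mulVec, Complex.re_sum, Finset.mul_sum, Pi.star_apply,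
      ← Finset.sum_add_distrib]
    refine Finset.sum_congr rfl fun i _ => Finset.sum_congr rfl fun j _ => ?_
    simp
  rw [key]
  have nn : ∀ x : Fin d → ℝ, 0 ≤ x ⬝ᵥ (B *ᵥ x) := fun x => by
    simpa using hB.posSemidef.dotProduct_mulVec_nonneg x
  have pp : ∀ x : Fin d → ℝ, x ≠ 0 → 0 < x ⬝ᵥ (B *ᵥ x) := fun x hx => by
    simpa using hB.dotProduct_mulVec_pos hx
  by_cases h : (fun i => (v i).re) = 0
  · have h' : (fun i => (v i).im) ≠ 0 := fun h' => hv (funext fun i =>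
      Complex.ext (congrFun h i) (congrFun h' i))
    exact add_pos_of_nonneg_of_pos (nn _) (pp _ h')
  · exact add_pos_of_pos_of_nonneg (pp _ h) (nn _)

theorem denom_isUnit {d : ℕ} (S : Matrix.symplecticGroup (Fin d) ℝ) (c : SiegelModel d)
    (hc : c ∈ siegel d) : IsUnit (denom S.1 c) := by
  rw [Matrix.isUnit_iff_isUnit_det, isUnit_iff_ne_zero]
  intro h0
  obtain ⟨v, hv, hv0⟩ := Matrix.exists_mulVec_eq_zero_iff.2 h0
  have hp := quad_pos hc hv
  have h := congrArg (fun A => star v ⬝ᵥ (A *ᵥ v)) (denom_conjTranspose S c)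
  have h1 : star v ⬝ᵥ (((denom S.1 c)ᴴ * numer S.1 c) *ᵥ v) = 0 := by
    rw [← mulVec_mulVec, dotProduct_mulVec, ← star_mulVec, hv0]; simp
  have h2 : star v ⬝ᵥ (((numer S.1 c)ᴴ * denom S.1 c) *ᵥ v) = 0 := by
    rw [← mulVec_mulVec, hv0]; simp
  simp only [sub_mulVec, dotProduct_sub, h1, h2, smul_mulVec, dotProduct_smul] at h
  rw [sub_zero] at h
  have : (2 * Complex.I) ≠ 0 := by simp
  rcases smul_eq_zero.1 h.symm with h' | h'
  · exact this h'
  · rw [h'] at hp; simp at hp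

theorem mobius_transpose {d : ℕ} (S : Matrix.symplecticGroup (Fin d) ℝ) (c : SiegelModel d)
    (hc : c ∈ siegel d) : (mobius S.1 c)ᵀ = mobius S.1 c := by
  have hu := denom_isUnit S c hc
  have hd : IsUnit (denom S.1 c).det := (Matrix.isUnit_iff_isUnit_det _).1 hu
  have hdT : IsUnit (denom S.1 c)ᵀ.det := by rwa [det_transpose]
  have h := denom_transpose S c
  rw [mobius, transpose_mul, transpose_nonsing_inv]
  calc ((denom S.1 c)ᵀ)⁻¹ * (numer S.1 c)ᵀ
      = ((denom S.1 c)ᵀ)⁻¹ * ((numer S.1 c)ᵀ * denom S.1 c) * (denom S.1 c)⁻¹ := by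
        rw [← Matrix.mul_assoc, mul_nonsing_inv_cancel_right _ _ hd]
    _ = numer S.1 c * (denom S.1 c)⁻¹ := by
        rw [← h, nonsing_inv_mul_cancel_left _ _ hdT]

theorem mobius_im {d : ℕ} (S : Matrix.symplecticGroup (Fin d) ℝ) (c : SiegelModel d)
    (hc : c ∈ siegel d) :
    ((mobius S.1 c).map Complex.im).map Complex.ofReal =
      ((denom S.1 c)⁻¹)ᴴ * (c.2 : Matrix (Fin d) (Fin d) ℝ).map Complex.ofReal *
        (denom S.1 c)⁻¹ := by
  have hu := denom_isUnit S c hc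
  have hd : IsUnit (denom S.1 c).det := (Matrix.isUnit_iff_isUnit_det _).1 hu
  have hdH : IsUnit (denom S.1 c)ᴴ.det := by
    rw [det_conjTranspose]; exact hd.star
  have h2 : (2 * Complex.I) ≠ 0 := by simp
  have e1 : mobius S.1 c - (mobius S.1 c)ᴴ =
      (2 * Complex.I) • ((mobius S.1 c).map Complex.im).map Complex.ofReal := by
    have h : (mobius S.1 c)ᴴ = ((mobius S.1 c)ᵀ).map star := rfl
    rw [h, mobius_transpose S c hc]
    ext i j
    rw [Matrix.sub_apply, Matrix.smul_apply, map_apply, map_apply, map_apply, smul_eq_mul]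
    apply Complex.ext <;> simp
    ring
  have e2 : mobius S.1 c - (mobius S.1 c)ᴴ = (2 * Complex.I) •
      (((denom S.1 c)⁻¹)ᴴ * (c.2 : Matrix (Fin d) (Fin d) ℝ).map Complex.ofReal *
        (denom S.1 c)⁻¹) := by
    rw [← Matrix.smul_mul, ← Matrix.mul_smul, ← denom_conjTranspose S c, mobius,
      conjTranspose_mul, conjTranspose_nonsing_inv, Matrix.mul_sub, Matrix.sub_mul,
      ← Matrix.mul_assoc, ← Matrix.mul_assoc, nonsing_inv_mul _ hdH, Matrix.one_mul,
      mul_nonsing_inv_cancel_right _ _ hd]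
  exact smul_right_injective _ h2 (e1.symm.trans e2)

theorem mobius_im_posDef {d : ℕ} (S : Matrix.symplecticGroup (Fin d) ℝ) (c : SiegelModel d)
    (hc : c ∈ siegel d) : ((mobius S.1 c).map Complex.im).PosDef := by
  refine PosDef.of_dotProduct_mulVec_pos ?_ fun {w} hw => ?_
  · change ((mobius S.1 c).map Complex.im)ᴴ = _
    rw [conjTranspose_eq_transpose_of_trivial, ← transpose_map, mobius_transpose S c hc]
  · have hd : IsUnit (denom S.1 c).det :=
      (Matrix.isUnit_iff_isUnit_det _).1 (denom_isUnit S c hc)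
    have hu : (denom S.1 c)⁻¹ *ᵥ (fun i => (w i : ℂ)) ≠ 0 := by
      intro h
      have h' := congrArg (fun x => denom S.1 c *ᵥ x) h
      simp only [mulVec_mulVec, mul_nonsing_inv _ hd, one_mulVec, mulVec_zero] at h'
      exact hw (funext fun i => by simpa using congrFun h' i)
    have hp := quad_pos hc hu
    rw [star_mulVec, ← dotProduct_mulVec, mulVec_mulVec, mulVec_mulVec,
      ← mobius_im S c hc] at hp
    have e : ∀ A : Matrix (Fin d) (Fin d) ℝ, ((star fun i => (w i : ℂ)) ⬝ᵥ
        (A.map Complex.ofReal *ᵥ fun i => (w i : ℂ))).re = star w ⬝ᵥ (A *ᵥ w) := fun A => by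
      simp [dotProduct, mulVec, Finset.mul_sum]
    rwa [e] at hp

/-- The action `Φ_S(𝒞) = (S₂₁ + S₂₂ 𝒞)(S₁₁ + S₁₂ 𝒞)⁻¹`. -/
def Phi {d : ℕ} (S : Matrix.symplecticGroup (Fin d) ℝ) (c : siegel d) : siegel d :=
  ⟨(⟨(mobius S.1 c.1).map Complex.re, by
      change ((mobius S.1 c.1).map Complex.re)ᵀ = _
      rw [← transpose_map, mobius_transpose S c.1 c.2]⟩,
    ⟨(mobius S.1 c.1).map Complex.im, by
      change ((mobius S.1 c.1).map Complex.im)ᵀ = _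
      rw [← transpose_map, mobius_transpose S c.1 c.2]⟩),
    mobius_im_posDef S c.1 c.2⟩

/-! ### The group `G = ℝ^{2d} × Sp(ℝ^{2d})`, its action on `𝒫`, and its exponential map -/

abbrev G (d : ℕ) : Type :=
  Multiplicative (PhaseSpace d) × Matrix.symplecticGroup (Fin d) ℝ

/-- `Ψ_{(δz, S)}(z, 𝒞) = (z + 𝕁 δz, Φ_S(𝒞))`. -/
def Psi {d : ℕ} (g : G d) (x : P d) : P d :=
  ⟨(x.1.1 + JJ d *ᵥ g.1.toAdd, (Phi g.2 ⟨x.1.2, x.2⟩).1), (Phi g.2 ⟨x.1.2, x.2⟩).2⟩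

/-- The identification `ξ ↦ ξ̃ = 𝕁ᵀ ξ` of `sym(2d, ℝ)` with the Lie algebra `sp(ℝ^{2d})`. -/
def tilde {d : ℕ} (ξ : Sym2 d) : Matrix (Fin d ⊕ Fin d) (Fin d ⊕ Fin d) ℝ :=
  (JJ d)ᵀ * (ξ : Matrix (Fin d ⊕ Fin d) (Fin d ⊕ Fin d) ℝ)

theorem exp_tilde_mem {d : ℕ} (ξ : Sym2 d) :
    NormedSpace.exp (tilde ξ) ∈ Matrix.symplecticGroup (Fin d) ℝ := by
  have hJu : IsUnit (Matrix.J (Fin d) ℝ) :=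
    (Matrix.isUnit_iff_isUnit_det _).2 (Matrix.isUnit_det_J _ _)
  have hconj : Matrix.J (Fin d) ℝ * (tilde ξ)ᵀ * (Matrix.J (Fin d) ℝ)⁻¹ = -tilde ξ := by
    rw [tilde, transpose_mul, transpose_transpose, Sym.transpose_eq, JJ_transpose, JJ_eq,
      Matrix.J_inv]
    simp only [Matrix.mul_neg, Matrix.neg_mul, neg_neg, Matrix.mul_assoc, Matrix.J_squared,
      Matrix.mul_one]
  have h := Matrix.exp_conj (Matrix.J (Fin d) ℝ) (tilde ξ)ᵀ hJu
  rw [hconj, Matrix.exp_neg, Matrix.exp_transpose] at h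
  have hu : IsUnit (NormedSpace.exp (tilde ξ)).det :=
    (Matrix.isUnit_iff_isUnit_det _).1 (Matrix.isUnit_exp _)
  rw [SymplecticGroup.mem_iff, Matrix.mul_assoc]
  have h2 : Matrix.J (Fin d) ℝ * (NormedSpace.exp (tilde ξ))ᵀ =
      (NormedSpace.exp (tilde ξ))⁻¹ * Matrix.J (Fin d) ℝ := by
    rw [h, Matrix.mul_assoc, Matrix.nonsing_inv_mul _ (Matrix.isUnit_det_J _ _),
      Matrix.mul_one]
  rw [h2, ← Matrix.mul_assoc, Matrix.mul_nonsing_inv _ hu, Matrix.one_mul]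

/-- The exponential map of `G`, on its Lie algebra `ℝ^{2d} × sp(ℝ^{2d}) ≅ ℝ^{2d} × sym(2d, ℝ)`. -/
def expG {d : ℕ} (a : PhaseSpace d × Sym2 d) : G d :=
  (Multiplicative.ofAdd a.1, ⟨NormedSpace.exp (tilde a.2), exp_tilde_mem a.2⟩)

/-- The curve `ε ↦ Ψ_{exp(ε a)}(x)`. -/
def orbitCurve {d : ℕ} (a : PhaseSpace d × Sym2 d) (x : P d) (ε : ℝ) : PModel d :=
  (Psi (expG (ε • a)) x).1

/-- The infinitesimal generator `a_𝒫(x) = d/dε|₀ Ψ_{exp(ε a)}(x)`. -/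
def infGen {d : ℕ} (a : PhaseSpace d × Sym2 d) (x : P d) : PModel d :=
  deriv (orbitCurve a x) 0

/-! ### Symplectic form, Hamiltonian vector fields and Poisson bracket on `𝒫` -/

/-- `Ω_{ℝ^{2d}}(z₁, z₂) = z₁ · 𝕁 z₂ = q₁ · p₂ - q₂ · p₁`. -/
def OmegaR {d : ℕ} (u v : PhaseSpace d) : ℝ := u ⬝ᵥ (JJ d *ᵥ v)

/-- `Ω_{ℍ_d} = ℬ⁻¹_{lj} ℬ⁻¹_{km} dℬ_{lm} ∧ d𝒜_{jk} = -dℬ⁻¹_{jk} ∧ d𝒜_{jk}` at `c = (𝒜, ℬ)`. -/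
def OmegaH {d : ℕ} (c u v : SiegelModel d) : ℝ :=
  let Binv : Matrix (Fin d) (Fin d) ℝ := (c.2 : Matrix (Fin d) (Fin d) ℝ)⁻¹
  trace (Binv * (u.2 : Matrix (Fin d) (Fin d) ℝ) * Binv * (v.1 : Matrix (Fin d) (Fin d) ℝ)) -
    trace (Binv * (v.2 : Matrix (Fin d) (Fin d) ℝ) * Binv * (u.1 : Matrix (Fin d) (Fin d) ℝ))

/-- The symplectic form `Ω = Ω_{ℝ^{2d}} - (ħ/4) Ω_{ℍ_d}` on `𝒫`, at the point `x`. -/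
def Omega {d : ℕ} (ħ : ℝ) (x u v : PModel d) : ℝ :=
  OmegaR u.1 v.1 - ħ / 4 * OmegaH x.2 u.2 v.2

/-- The value at `x` of the Hamiltonian vector field of `F`: the vector `X` with
`Ω(X, ·) = dF`. By `existsUnique_hamVec` below there is exactly one if `x ∈ 𝒫` and `ħ ≠ 0`. -/
def hamVec {d : ℕ} (ħ : ℝ) (F : PModel d → ℝ) (x : PModel d) : PModel d :=
  Classical.epsilon fun X => ∀ v, Omega ħ x X v = fderiv ℝ F x v

/-- `{F, G}_𝒫 = Ω(X_F, X_G)`. -/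
def poissonP {d : ℕ} (ħ : ℝ) (F K : PModel d → ℝ) (x : PModel d) : ℝ :=
  Omega ħ x (hamVec ħ F x) (hamVec ħ K x)

/-! ### Gradients -/

/-- The symmetric matrix `(E_{ij} + E_{ji}) / 2`. -/
def symUnit {n : Type} [DecidableEq n] (i j : n) : Sym n :=
  ⟨(1 / 2 : ℝ) • (Matrix.single i j 1 + Matrix.single j i 1), by
    change ((1 / 2 : ℝ) • (Matrix.single i j (1 : ℝ) + Matrix.single j i 1))ᵀ = _
    rw [transpose_smul, transpose_add, transpose_single, transpose_single, add_comm]⟩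

/-- The symmetric matrix that represents a linear form `ℓ` on `sym(n, ℝ)` by the pairing
`⟨ξ, η⟩ = tr(ξ η)`; see `trace_symGrad_mul`. -/
def symGrad {n : Type} [DecidableEq n] (ℓ : Sym n →ₗ[ℝ] ℝ) : Sym n :=
  ⟨Matrix.of fun i j => ℓ (symUnit i j), by
    change (Matrix.of fun i j => ℓ (symUnit i j))ᵀ = _
    ext i j
    simp only [transpose_apply, of_apply]
    congr 1
    apply Subtype.ext
    simp only [symUnit, add_comm]⟩

theorem trace_symGrad_mul {n : Type} [Fintype n] [DecidableEq n] (ℓ : Sym n →ₗ[ℝ] ℝ)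
    (η : Sym n) : trace ((symGrad ℓ : Matrix n n ℝ) * (η : Matrix n n ℝ)) = ℓ η := by
  have hη : η = ∑ i, ∑ j, (η : Matrix n n ℝ) j i • symUnit i j := by
    apply Subtype.ext
    ext a b
    have hs : (η : Matrix n n ℝ) a b = (η : Matrix n n ℝ) b a := by
      conv_lhs => rw [← Sym.transpose_eq η]
      rfl
    simp only [Submodule.coe_sum, Submodule.coe_smul, symUnit, Matrix.sum_apply,
      Matrix.smul_apply, Matrix.add_apply, Matrix.single_apply, smul_eq_mul]
    simp only [mul_add, Finset.sum_add_distrib, ite_and, mul_ite, mul_one, mul_zero,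
      Finset.sum_ite_irrel, Finset.sum_const_zero, Finset.sum_ite_eq', Finset.mem_univ, if_true]
    rw [← hs]; ring
  conv_rhs => rw [hη]
  simp only [map_sum, map_smul, trace, diag, Matrix.mul_apply, symGrad, of_apply, smul_eq_mul]
  exact Finset.sum_congr rfl fun i _ => Finset.sum_congr rfl fun j _ => mul_comm _ _

/-- The partial derivative `∂f/∂x_i`. -/
def pderiv {ι : Type} [Fintype ι] [DecidableEq ι] (f : (ι → ℝ) → ℝ) (i : ι) (x : ι → ℝ) : ℝ :=
  fderiv ℝ f x (Pi.single i 1)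

/-- The Hessian matrix `D²f(x)`. -/
def hessian {ι : Type} [Fintype ι] [DecidableEq ι] (f : (ι → ℝ) → ℝ) (x : ι → ℝ) :
    Matrix ι ι ℝ :=
  Matrix.of fun i j => pderiv (pderiv f j) i x

/-- The partial derivative `∂f/∂z_i` of a function of `(z, Σ)`. -/
def dz {d : ℕ} (f : Moments d → ℝ) (w : Moments d) (i : Fin d ⊕ Fin d) : ℝ :=
  fderiv ℝ f w (Pi.single i 1, 0)

/-- `δf/δΣ`, the gradient for the pairing `tr(ξ η)` of a function of `(z, Σ)`. -/
def dSigma {d : ℕ} (f : Moments d → ℝ) (w : Moments d) : Sym2 d :=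
  symGrad ((fderiv ℝ f w).toLinearMap ∘ₗ LinearMap.inr ℝ (PhaseSpace d) (Sym2 d))

/-- The symmetric matrix `B X B`. -/
def sandwich {n : Type} [Fintype n] (B X : Sym n) : Sym n :=
  ⟨B.1 * X.1 * B.1, by
    change (B.1 * X.1 * B.1)ᵀ = _
    simp only [transpose_mul, Sym.transpose_eq, Matrix.mul_assoc]⟩

theorem JJ_transpose_mul (d : ℕ) : (JJ d)ᵀ * JJ d = 1 := by
  rw [JJ_eq]; simp [Matrix.J_squared]

theorem inv_sandwich {d : ℕ} {B : Sym (Fin d)} (hB : B.1.PosDef) (X : Sym (Fin d)) :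
    (B.1)⁻¹ * (sandwich B X).1 * (B.1)⁻¹ = X.1 := by
  have hd : IsUnit (B.1).det := (Matrix.isUnit_iff_isUnit_det _).1 hB.isUnit
  rw [sandwich, ← Matrix.mul_assoc, ← Matrix.mul_assoc, nonsing_inv_mul _ hd, Matrix.one_mul,
    mul_nonsing_inv_cancel_right _ _ hd]

theorem Omega_sub {d : ℕ} (ħ : ℝ) (x u u' v : PModel d) :
    Omega ħ x (u - u') v = Omega ħ x u v - Omega ħ x u' v := by
  simp only [Omega, OmegaR, OmegaH, Prod.fst_sub, Prod.snd_sub, sub_dotProduct,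
    Submodule.coe_sub, Matrix.mul_sub, Matrix.sub_mul, trace_sub]
  ring

theorem eq_zero_of_trace_mul_self {n : Type} [Fintype n] (A : Sym n)
    (hA : trace (A.1 * A.1) = 0) : A = 0 := by
  apply Subtype.ext
  apply trace_conjTranspose_mul_self_eq_zero_iff.1
  rwa [conjTranspose_eq_transpose_of_trivial, Sym.transpose_eq]

theorem eq_zero_of_Omega {d : ℕ} {ħ : ℝ} (hħ : ħ ≠ 0) {x : PModel d} (hx : x ∈ P d)
    {X : PModel d} (hX : ∀ v, Omega ħ x X v = 0) : X = 0 := by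
  have h4 : ħ / 4 ≠ 0 := by positivity
  have hB : (x.2.2.1).PosDef := hx
  have h1 := hX ((JJ d)ᵀ *ᵥ X.1, 0)
  have h2 := hX (0, (sandwich x.2.2 X.2.2, 0))
  have h3 := hX (0, (0, sandwich x.2.2 X.2.1))
  have hJ : JJ d * (JJ d)ᵀ = 1 := by
    rw [JJ_eq]; simp [Matrix.J_squared]
  simp only [Omega, OmegaR, OmegaH, mulVec_mulVec, hJ, one_mulVec, Prod.fst_zero,
    Prod.snd_zero, ZeroMemClass.coe_zero, Matrix.zero_mul, trace_zero,
    sub_zero, mul_zero, mulVec_zero, dotProduct_zero, zero_sub, inv_sandwich hB] at h1 h2 h3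
  have e2 : trace (X.2.2.1 * X.2.2.1) = 0 := by
    have : trace ((x.2.2.1)⁻¹ * X.2.2.1 * (x.2.2.1)⁻¹ * (sandwich x.2.2 X.2.2).1) =
        trace (X.2.2.1 * X.2.2.1) := by
      rw [Matrix.mul_assoc, Matrix.mul_assoc, trace_mul_comm, Matrix.mul_assoc, Matrix.mul_assoc,
        ← Matrix.mul_assoc ((x.2.2.1)⁻¹), inv_sandwich hB]
    rw [this] at h2
    simpa [h4, hħ] using h2
  have e3 : trace (X.2.1.1 * X.2.1.1) = 0 := by simpa [h4, hħ] using h3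
  refine Prod.ext (dotProduct_self_eq_zero.1 h1) (Prod.ext ?_ ?_)
  · exact eq_zero_of_trace_mul_self _ e3
  · exact eq_zero_of_trace_mul_self _ e2

/-- There is exactly one Hamiltonian vector for each differential. -/
theorem existsUnique_hamVec {d : ℕ} {ħ : ℝ} (hħ : ħ ≠ 0) {x : PModel d} (hx : x ∈ P d)
    (ℓ : PModel d →L[ℝ] ℝ) : ∃! X, ∀ v, Omega ħ x X v = ℓ v := by
  have hB : (x.2.2.1).PosDef := hx
  let g : PhaseSpace d := fun i => ℓ (Pi.single i 1, 0)
  let gA : Sym (Fin d) := symGrad (ℓ.toLinearMap ∘ₗ LinearMap.inr ℝ _ _ ∘ₗ LinearMap.inl ℝ _ _)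
  let gB : Sym (Fin d) := symGrad (ℓ.toLinearMap ∘ₗ LinearMap.inr ℝ _ _ ∘ₗ LinearMap.inr ℝ _ _)
  have hex : ∀ v, Omega ħ x
      (JJ d *ᵥ g, ((4 / ħ) • sandwich x.2.2 gB, -((4 / ħ) • sandwich x.2.2 gA))) v = ℓ v := by
    intro v
    have hv : v = (v.1, 0) + ((0, (v.2.1, 0)) + (0, (0, v.2.2))) := by
      ext <;> simp
    have e1 : ℓ (v.1, 0) = g ⬝ᵥ v.1 := by
      have hs : (v.1, (0 : SiegelModel d)) =
          ∑ i, v.1 i • ((Pi.single i 1, 0) : PModel d) := by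
        refine Prod.ext ?_ ?_
        · rw [Prod.fst_sum]
          ext j
          simp [Finset.sum_apply, Pi.single_apply]
        · rw [Prod.snd_sum]
          simp
      rw [hs, map_sum]
      simp only [map_smul, smul_eq_mul, dotProduct, g]
      exact Finset.sum_congr rfl fun i _ => mul_comm _ _
    have e2 : ℓ (0, (v.2.1, 0)) = trace (gA.1 * v.2.1.1) :=
      (trace_symGrad_mul (ℓ.toLinearMap ∘ₗ LinearMap.inr ℝ (PhaseSpace d) (SiegelModel d) ∘ₗ
        LinearMap.inl ℝ (Sym (Fin d)) (Sym (Fin d))) v.2.1).symm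
    have e3 : ℓ (0, (0, v.2.2)) = trace (gB.1 * v.2.2.1) :=
      (trace_symGrad_mul (ℓ.toLinearMap ∘ₗ LinearMap.inr ℝ (PhaseSpace d) (SiegelModel d) ∘ₗ
        LinearMap.inr ℝ (Sym (Fin d)) (Sym (Fin d))) v.2.2).symm
    have e4 : trace ((x.2.2.1)⁻¹ * v.2.2.1 * (x.2.2.1)⁻¹ * (sandwich x.2.2 gB).1) =
        trace (gB.1 * v.2.2.1) := by
      rw [Matrix.mul_assoc, Matrix.mul_assoc, trace_mul_comm, Matrix.mul_assoc, Matrix.mul_assoc,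
        ← Matrix.mul_assoc ((x.2.2.1)⁻¹), inv_sandwich hB, trace_mul_comm]
    have e5 : (JJ d *ᵥ g) ⬝ᵥ (JJ d *ᵥ v.1) = g ⬝ᵥ v.1 := by
      rw [dotProduct_mulVec, ← mulVec_transpose, mulVec_mulVec, JJ_transpose_mul, one_mulVec]
    conv_rhs => rw [hv, map_add, map_add, e1, e2, e3]
    simp only [Omega, OmegaR, OmegaH, e5, Submodule.coe_neg, Submodule.coe_smul, Matrix.mul_neg,
      Matrix.neg_mul, Matrix.mul_smul, Matrix.smul_mul, trace_neg, trace_smul, inv_sandwich hB,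
      e4, smul_eq_mul]
    field_simp
    ring
  refine ⟨_, hex, fun Y hY => ?_⟩
  rw [← sub_eq_zero]
  refine eq_zero_of_Omega hħ hx fun v => ?_
  rw [Omega_sub, hY, hex, sub_self]

/-! ### The Lie algebra `sym(2d, ℝ)`, coadjoint orbits, the moment bracket -/

/-- `[ξ, η]_sym = ξ 𝕁ᵀ η - η 𝕁ᵀ ξ`. -/
def symBracket {d : ℕ} (ξ η : Sym2 d) : Sym2 d :=
  ⟨ξ.1 * (JJ d)ᵀ * η.1 - η.1 * (JJ d)ᵀ * ξ.1, by
    change (ξ.1 * (JJ d)ᵀ * η.1 - η.1 * (JJ d)ᵀ * ξ.1)ᵀ = _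
    simp only [transpose_sub, transpose_mul, Sym.transpose_eq, JJ_transpose, Matrix.mul_neg,
      Matrix.neg_mul, transpose_neg, Matrix.mul_assoc]
    abel⟩

/-- `ad*_ξ μ = 𝕁 ξ μ - μ ξ 𝕁`. -/
def adStar {d : ℕ} (ξ μ : Sym2 d) : Sym2 d :=
  ⟨JJ d * ξ.1 * μ.1 - μ.1 * ξ.1 * JJ d, by
    change (JJ d * ξ.1 * μ.1 - μ.1 * ξ.1 * JJ d)ᵀ = _
    simp only [transpose_sub, transpose_mul, Sym.transpose_eq, JJ_transpose, Matrix.mul_neg,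
      Matrix.neg_mul, Matrix.mul_assoc]
    abel⟩

/-- The coadjoint action `Ad*_{S⁻¹} μ = S μ Sᵀ`. -/
def coAd {d : ℕ} (S : Matrix.symplecticGroup (Fin d) ℝ) (μ : Sym2 d) : Sym2 d :=
  ⟨S.1 * μ.1 * S.1ᵀ, by
    change (S.1 * μ.1 * S.1ᵀ)ᵀ = _
    simp only [transpose_mul, transpose_transpose, Sym.transpose_eq, Matrix.mul_assoc]⟩

/-- The coadjoint orbit through `μ`. -/
def coadjointOrbit {d : ℕ} (μ : Sym2 d) : Set (Sym2 d) := Set.range fun S => coAd S μ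

/-- The tangent space `{ad*_ξ μ}` at `μ` of the coadjoint orbit through `μ`. -/
def orbitTangent {d : ℕ} (μ : Sym2 d) : Set (Sym2 d) := Set.range fun ξ => adStar ξ μ

/-- The `(+)`-Kirillov–Kostant–Souriau form: `Ω_𝒪⁺(μ)(ad*_ξ μ, ad*_η μ) = tr(μ [ξ, η]_sym)`.
It is independent of the choice of `ξ` and `η`, see `kks_adStar`. -/
def kks {d : ℕ} (μ u v : Sym2 d) : ℝ :=
  trace (μ.1 * (symBracket (Classical.epsilon fun ξ => adStar ξ μ = u)
    (Classical.epsilon fun η => adStar η μ = v)).1)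

theorem trace_mul_symBracket {d : ℕ} (μ ξ η : Sym2 d) :
    trace (μ.1 * (symBracket ξ η).1) = trace ((adStar ξ μ).1 * η.1) := by
  have h1 : trace (μ.1 * (η.1 * (JJ d * ξ.1))) = trace (JJ d * (ξ.1 * (μ.1 * η.1))) := by
    rw [← Matrix.mul_assoc, trace_mul_comm, Matrix.mul_assoc]
  simp only [symBracket, adStar, JJ_transpose, Matrix.mul_sub, Matrix.sub_mul, Matrix.mul_neg,
    Matrix.neg_mul, trace_sub, trace_neg, Matrix.mul_assoc, h1]
  ring

theorem trace_mul_symBracket' {d : ℕ} (μ ξ η : Sym2 d) :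
    trace (μ.1 * (symBracket ξ η).1) = -trace ((adStar η μ).1 * ξ.1) := by
  rw [← trace_mul_symBracket, ← trace_neg, ← Matrix.mul_neg]
  congr 2
  simp only [symBracket, neg_sub]

theorem kks_adStar {d : ℕ} (μ ξ η : Sym2 d) :
    kks μ (adStar ξ μ) (adStar η μ) = trace (μ.1 * (symBracket ξ η).1) := by
  have h1 := Classical.epsilon_spec (p := fun ζ => adStar ζ μ = adStar ξ μ) ⟨ξ, rfl⟩
  have h2 := Classical.epsilon_spec (p := fun ζ => adStar ζ μ = adStar η μ) ⟨η, rfl⟩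
  rw [kks, trace_mul_symBracket, h1, ← trace_mul_symBracket, trace_mul_symBracket', h2,
    ← trace_mul_symBracket']

/-- The form `ω = Ω_{ℝ^{2d}} - (ħ/4) Ω_𝒪⁺` on `ℝ^{2d} × 𝒪`, at the point `w = (z, Σ)`, for
tangent vectors `u`, `v` in `ℝ^{2d} × T_Σ 𝒪`. -/
def omega {d : ℕ} (ħ : ℝ) (w u v : Moments d) : ℝ :=
  OmegaR u.1 v.1 - ħ / 4 * kks w.2 u.2 v.2

/-- `ℝ^{2d} × T_Σ 𝒪`, the tangent space of `ℝ^{2d} × 𝒪` at `w = (z, Σ)`. -/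
def momentTangent {d : ℕ} (w : Moments d) : Set (Moments d) := {u | u.2 ∈ orbitTangent w.2}

/-- The canonical bracket in `z = (q, p)`, with `Σ` fixed. -/
def poissonR {d : ℕ} (f g : Moments d → ℝ) (w : Moments d) : ℝ :=
  ∑ i : Fin d, (dz f w (Sum.inl i) * dz g w (Sum.inr i) - dz g w (Sum.inl i) * dz f w (Sum.inr i))

/-- The bracket `{f, g}(z, Σ) = {f, g}_{ℝ^{2d}} - (4/ħ) tr(Σ [δf/δΣ, δg/δΣ]_sym)` of the
Gaussian moments. -/
def poissonMoments {d : ℕ} (ħ : ℝ) (f g : Moments d → ℝ) (w : Moments d) : ℝ :=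
  poissonR f g w - 4 / ħ * trace (w.2.1 * (symBracket (dSigma f w) (dSigma g w)).1)

/-! ### The map `M` and the notion of a momentum map -/

/-- The covariance matrix `σ(𝒞)`. -/
def sigma {d : ℕ} (c : SiegelModel d) : Sym2 d :=
  ⟨fromBlocks (c.2.1)⁻¹ ((c.2.1)⁻¹ * c.1.1) (c.1.1 * (c.2.1)⁻¹)
      (c.1.1 * (c.2.1)⁻¹ * c.1.1 + c.2.1), by
    change (fromBlocks (c.2.1)⁻¹ ((c.2.1)⁻¹ * c.1.1) (c.1.1 * (c.2.1)⁻¹)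
      (c.1.1 * (c.2.1)⁻¹ * c.1.1 + c.2.1))ᵀ = _
    simp only [fromBlocks_transpose, transpose_mul, transpose_add, transpose_nonsing_inv,
      Sym.transpose_eq, Matrix.mul_assoc]⟩

/-- `M(z, 𝒞) = (z, σ(𝒞))`. -/
def M {d : ℕ} (x : PModel d) : Moments d := (x.1, sigma x.2)

/-- The pairing of `ℝ^{2d} × sym(2d, ℝ)` with the Lie algebra of `G` by which it is identified
with the dual of that Lie algebra. The factor `-ħ/4` is that of the form `Ω`. -/
def pairing {d : ℕ} (ħ : ℝ) (w : Moments d) (a : PhaseSpace d × Sym2 d) : ℝ :=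
  w.1 ⬝ᵥ a.1 - ħ / 4 * trace (w.2.1 * a.2.1)

/-- `K : 𝒫 → ℝ^{2d} × sym(2d, ℝ)` is a momentum map of the action `Ψ` on `(𝒫, Ω)`: it is smooth
and `Ω(a_𝒫, ·) = d⟨K, a⟩` for every `a` in the Lie algebra of `G`. -/
def IsMomentumMap {d : ℕ} (ħ : ℝ) (K : PModel d → Moments d) : Prop :=
  ContDiffOn ℝ ∞ K (P d) ∧
    ∀ (a : PhaseSpace d × Sym2 d) (x : P d) (v : PModel d),
      Omega ħ x.1 (infGen a x) v = fderiv ℝ (fun y => pairing ħ (K y) a) x.1 v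

/-- The action `(δz, S) · (z, Σ) = (z + 𝕁 δz, Ad*_{S⁻¹} Σ)` of `G` on `ℝ^{2d} × sym(2d, ℝ)`.
The coadjoint action of `G` is `(z, Σ) ↦ (z, Ad*_{S⁻¹} Σ)`, because `ℝ^{2d}` is abelian; this is
the affine action with that linear part whose orbits are the sets `ℝ^{2d} × 𝒪`. -/
def momentAct {d : ℕ} (g : G d) (w : Moments d) : Moments d :=
  (w.1 + JJ d *ᵥ g.1.toAdd, coAd g.2 w.2)

/-! ### Hamiltonians -/

/-- `H_cl(q, p) = p²/(2m) + V(q)`. -/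
def Hcl {d : ℕ} (m : ℝ) (V : (Fin d → ℝ) → ℝ) (z : PhaseSpace d) : ℝ :=
  (z ∘ Sum.inr) ⬝ᵥ (z ∘ Sum.inr) / (2 * m) + V (z ∘ Sum.inl)

/-- The Hamiltonian `H = p²/(2m) + V + (ħ/4) tr[ℬ⁻¹((𝒜² + ℬ²)/m + D²V)]` on `𝒫`. -/
def H {d : ℕ} (ħ m : ℝ) (V : (Fin d → ℝ) → ℝ) (x : PModel d) : ℝ :=
  (x.1 ∘ Sum.inr) ⬝ᵥ (x.1 ∘ Sum.inr) / (2 * m) + V (x.1 ∘ Sum.inl) +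
    ħ / 4 * trace ((x.2.2.1)⁻¹ *
      ((1 / m) • (x.2.1.1 ^ 2 + x.2.2.1 ^ 2) + hessian V (x.1 ∘ Sum.inl)))

/-- The Hamiltonian `h = p²/(2m) + V + (ħ/4) tr(Σ₂₂/m + Σ₁₁ D²V)` on `ℝ^{2d} × sym(2d, ℝ)`. -/
def h {d : ℕ} (ħ m : ℝ) (V : (Fin d → ℝ) → ℝ) (w : Moments d) : ℝ :=
  (w.1 ∘ Sum.inr) ⬝ᵥ (w.1 ∘ Sum.inr) / (2 * m) + V (w.1 ∘ Sum.inl) +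
    ħ / 4 * trace ((1 / m) • w.2.1.toBlocks₂₂ + w.2.1.toBlocks₁₁ * hessian V (w.1 ∘ Sum.inl))

/-- `X` is the Hamiltonian vector of `f` at a point `w` of `ℝ^{2d} × 𝒪`: it is tangent and
`ω(X, v) = df(v)` for all tangent `v`. -/
def IsHamVecMoments {d : ℕ} (ħ : ℝ) (f : Moments d → ℝ) (w X : Moments d) : Prop :=
  X ∈ momentTangent w ∧ ∀ v ∈ momentTangent w, omega ħ w X v = fderiv ℝ f w v

end GWP

end

noncomputable section

namespace GWP

/-! ### Calculus of matrix-valued functions -/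

section MatrixCalculus

variable {l n k : Type} [Fintype l] [Fintype n] [Fintype k]

/-! Write ξ_ℍ(𝒞) = ξ₁₁ + ξ₁₂𝒞 + 𝒞ξ₂₁ + 𝒞ξ₂₂𝒞 for the generator of ξ on ℍ_d (`siegelGen`). Two
block-matrix identities carry the theorem: Ω_ℍ(ξ_ℍ, v) = tr(ξ dσ(v)) (`OmegaH_siegelGen`), which
says that σ is a momentum map on the Siegel factor, and dσ(ξ_ℍ) = -ad*_ξ σ (`dsigma_siegelGen`), its
infinitesimal equivariance. Since every tangent vector of ℍ_d is some ξ_ℍ (`exists_siegelGen_eq`),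
together they give σ^*Ω_𝒪⁺ = Ω_ℍ (`kks_dsigma`), hence M^*ω = Ω.

Global equivariance rests on [I; 𝒞] ℬ⁻¹ [I; 𝒞]ᴴ = σ(𝒞) - i𝕁 and S[I; 𝒞] = [I; Φ_S(𝒞)](S₁₁ + S₁₂𝒞):
the action on ℍ_d is linear on Lagrangian frames, and σ is quadratic in the frame (`sigma_Phi`).
That ξ_ℍ really is the derivative of the orbit curve follows by transport through σ, which has an
explicit smooth left inverse: on the other side one only differentiates S(t) σ S(t)ᵀ
(`hasDerivAt_orbitCurve`).

A function f ∘ M is collective: at each point its Hamiltonian vector is the generator of the frozen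
Lie algebra element (∂f/∂z, -(4/ħ) δf/δΣ) (`fderiv_M_hamVec`). This gives the Poisson property and,
since H = h ∘ M on 𝒫, the reduced dynamics. The symplectic group is transitive on the covariance
matrices σ(𝒞), so M is a bijection from 𝒫 onto ℝ^{2d} × 𝒪, and X_h ∘ M = TM ∘ X_H has exactly one
solution. -/

theorem hasDerivAt_matrix {l n : Type} [Fintype n] {f : ℝ → Matrix l n ℝ}
    {f' : Matrix l n ℝ} {t : ℝ} :
    HasDerivAt f f' t ↔ ∀ i j, HasDerivAt (fun s => f s i j) (f' i j) t := by
  refine (hasDerivAt_pi (φ := f) (φ' := f')).trans ?_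
  exact forall_congr' fun i => hasDerivAt_pi

theorem contDiffAt_matrix {E : Type*} [NormedAddCommGroup E] [NormedSpace ℝ E] {r : WithTop ℕ∞}
    {f : E → Matrix l n ℝ} {x : E} :
    ContDiffAt ℝ r f x ↔ ∀ i j, ContDiffAt ℝ r (fun y => f y i j) x := by
  refine (contDiffAt_pi (Φ := f)).trans ?_
  exact forall_congr' fun i => contDiffAt_pi

theorem hasDerivAt_matrix_mul {l : Type} {f : ℝ → Matrix l n ℝ} {g : ℝ → Matrix n k ℝ}
    {f' : Matrix l n ℝ} {g' : Matrix n k ℝ} {t : ℝ} (hf : HasDerivAt f f' t)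
    (hg : HasDerivAt g g' t) :
    HasDerivAt (fun s => f s * g s) (f' * g t + f t * g') t := by
  rw [hasDerivAt_matrix] at *
  intro i j
  simp only [Matrix.mul_apply, Matrix.add_apply, ← Finset.sum_add_distrib]
  exact HasDerivAt.fun_sum fun a _ => (hf i a).mul (hg a j)

theorem hasDerivAt_matrix_transpose {f : ℝ → Matrix l n ℝ} {f' : Matrix l n ℝ} {t : ℝ}
    (hf : HasDerivAt f f' t) : HasDerivAt (fun s => (f s)ᵀ) f'ᵀ t := by
  rw [hasDerivAt_matrix] at *
  exact fun i j => hf j i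

theorem contDiffAt_matrix_mul {E : Type*} [NormedAddCommGroup E] [NormedSpace ℝ E]
    {r : WithTop ℕ∞} {f : E → Matrix l n ℝ} {g : E → Matrix n k ℝ} {x : E}
    (hf : ContDiffAt ℝ r f x) (hg : ContDiffAt ℝ r g x) :
    ContDiffAt ℝ r (fun y => f y * g y) x := by
  rw [contDiffAt_matrix] at *
  intro i j
  simp only [Matrix.mul_apply]
  exact ContDiffAt.sum fun a _ => (hf i a).mul (hg a j)

theorem contDiffAt_matrix_det [DecidableEq n] {E : Type*} [NormedAddCommGroup E]
    [NormedSpace ℝ E] {r : WithTop ℕ∞} {f : E → Matrix n n ℝ} {x : E} (hf : ContDiffAt ℝ r f x) :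
    ContDiffAt ℝ r (fun y => (f y).det) x := by
  rw [contDiffAt_matrix] at hf
  simp only [Matrix.det_apply']
  exact ContDiffAt.sum fun p _ => contDiffAt_const.mul (contDiffAt_prod fun i _ => hf _ _)

/-- Cramer's rule: each entry of the inverse is a minor-type determinant, polynomial in the entries,
divided by the nonvanishing determinant. -/
theorem contDiffAt_matrix_inv [DecidableEq n] {E : Type*} [NormedAddCommGroup E]
    [NormedSpace ℝ E] {r : WithTop ℕ∞} {f : E → Matrix n n ℝ} {x : E} (hf : ContDiffAt ℝ r f x)
    (hx : IsUnit (f x).det) : ContDiffAt ℝ r (fun y => (f y)⁻¹) x := by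
  have hadj : ∀ i j, ContDiffAt ℝ r (fun y => (f y).adjugate i j) x := by
    intro i j
    simp only [adjugate_apply]
    refine contDiffAt_matrix_det (contDiffAt_matrix.2 fun a b => ?_)
    -- The adjugate entry is the determinant with row j replaced by a basis vector, so that row is
    -- constant and the others are rows of f.
    by_cases h : a = j
    · simp only [updateRow_apply, h, if_true]; exact contDiffAt_const
    · simp only [updateRow_apply, h, if_false]; exact contDiffAt_matrix.1 hf a b
  refine contDiffAt_matrix.2 fun i j => ?_
  simp only [Matrix.inv_def, Matrix.smul_apply, smul_eq_mul, Ring.inverse_eq_inv']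
  exact ((contDiffAt_matrix_det hf).inv hx.ne_zero).mul (hadj i j)

/-- Smoothness of inversion supplies some derivative; its value is forced by differentiating f · f⁻¹
= 1, which holds near t because invertibility is an open condition. -/
theorem hasDerivAt_matrix_inv [DecidableEq n] {f : ℝ → Matrix n n ℝ} {f' : Matrix n n ℝ} {t : ℝ}
    (hf : HasDerivAt f f' t) (ht : IsUnit (f t).det) :
    HasDerivAt (fun s => (f s)⁻¹) (-((f t)⁻¹ * f' * (f t)⁻¹)) t := by
  have hd : DifferentiableAt ℝ (fun A : Matrix n n ℝ => A⁻¹) (f t) :=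
    (contDiffAt_matrix_inv (r := 1) (f := id) contDiffAt_id ht).differentiableAt (by simp)
  have hg : HasDerivAt (fun s => (f s)⁻¹) (deriv (fun s => (f s)⁻¹) t) t :=
    (DifferentiableAt.comp t hd hf.differentiableAt).hasDerivAt
  have hU : ∀ᶠ s in nhds t, IsUnit (f s).det := by
    have hc : ContinuousAt (fun s => (f s).det) t :=
      (continuous_id.matrix_det.continuousAt (x := f t)).comp hf.continuousAt
    filter_upwards [hc.eventually_ne ht.ne_zero] with s hs using isUnit_iff_ne_zero.2 hs
  have h1 := hasDerivAt_matrix_mul hf hg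
  have h2 : HasDerivAt (fun s => f s * (f s)⁻¹) 0 t :=
    (hasDerivAt_const t (1 : Matrix n n ℝ)).congr_of_eventuallyEq
      (hU.mono fun s hs => mul_nonsing_inv _ hs)
  have h3 := h1.unique h2
  convert hg using 1
  have h4 := congrArg (fun X => (f t)⁻¹ * X) h3
  simp only [Matrix.mul_add, Matrix.mul_zero, nonsing_inv_mul_cancel_left _ _ ht] at h4
  rw [Matrix.mul_assoc]
  exact (eq_neg_of_add_eq_zero_right h4).symm

/-! ### Calculus inside the space of symmetric matrices -/

/-- The projection `A ↦ (A + Aᵀ) / 2` onto the symmetric matrices. -/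
def symProj : Matrix n n ℝ →L[ℝ] Sym n :=
  LinearMap.toContinuousLinearMap
    { toFun := fun A => ⟨(1 / 2 : ℝ) • (A + Aᵀ), by
        change ((1 / 2 : ℝ) • (A + Aᵀ))ᵀ = _
        rw [transpose_smul, transpose_add, transpose_transpose, add_comm]⟩
      map_add' := fun A B => Subtype.ext (by
        simp only [transpose_add, Submodule.coe_add, ← smul_add]
        congr 1
        abel)
      map_smul' := fun c A => Subtype.ext (by
        simp only [transpose_smul, ← smul_add, RingHom.id_apply, Submodule.coe_smul]
        rw [smul_comm]) }

theorem symProj_coe (A : Sym n) : symProj (A : Matrix n n ℝ) = A := by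
  apply Subtype.ext
  change (1 / 2 : ℝ) • (A.1 + A.1ᵀ) = A.1
  rw [Sym.transpose_eq, ← two_smul ℝ, smul_smul]
  norm_num

/-- `symProj` is a continuous linear left inverse of the inclusion, so derivatives may be computed
in the ambient matrix space. -/
theorem hasDerivAt_sym {f : ℝ → Sym n} {f' : Sym n} {t : ℝ} :
    HasDerivAt f f' t ↔ HasDerivAt (fun s => (f s : Matrix n n ℝ)) (f' : Matrix n n ℝ) t := by
  constructor
  · intro h
    exact ((symSubmodule n).subtypeL.hasFDerivAt.comp_hasDerivAt t h :)
  · intro h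
    have := (symProj (n := n)).hasFDerivAt.comp_hasDerivAt t h
    exact (this.congr_deriv (symProj_coe f')).congr_of_eventuallyEq
      (.of_forall fun s => (symProj_coe (f s)).symm)

theorem differentiableAt_sym {f : ℝ → Sym n} {t : ℝ}
    (h : DifferentiableAt ℝ (fun s => (f s : Matrix n n ℝ)) t) : DifferentiableAt ℝ f t := by
  have := (symProj (n := n)).hasFDerivAt.comp_hasDerivAt t h.hasDerivAt
  exact (this.congr_of_eventuallyEq
    (.of_forall fun s => (symProj_coe (f s)).symm)).differentiableAt

theorem contDiffAt_sym {E : Type*} [NormedAddCommGroup E] [NormedSpace ℝ E] {r : WithTop ℕ∞}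
    {f : E → Sym n} {x : E} :
    ContDiffAt ℝ r f x ↔ ContDiffAt ℝ r (fun y => (f y : Matrix n n ℝ)) x := by
  constructor
  · intro h
    exact ((symSubmodule n).subtypeL.contDiff.contDiffAt.comp x h :)
  · intro h
    have := (symProj (n := n)).contDiff.contDiffAt.comp x h
    exact this.congr_of_eventuallyEq (.of_forall fun y => (symProj_coe (f y)).symm)

theorem contDiff_sym_coe {r : WithTop ℕ∞} :
    ContDiff ℝ r (fun A : Sym n => (A : Matrix n n ℝ)) :=
  (symSubmodule n).subtypeL.contDiff

/-- The positive definite matrices form an open subset of the symmetric matrices. -/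
theorem isOpen_posDef : IsOpen {A : Sym n | (A : Matrix n n ℝ).PosDef} := by
  classical
  rw [isOpen_iff_mem_nhds]
  intro A hA
  have hcont : Continuous fun y : Sym n × (n → ℝ) => y.2 ⬝ᵥ (y.1.1 *ᵥ y.2) :=
    Continuous.dotProduct continuous_snd
      ((continuous_subtype_val.comp continuous_fst).matrix_mulVec continuous_snd)
  -- Positivity of the quadratic form need only be tested on the unit sphere, whose compactness
  -- gives one neighbourhood of A that works for all v.
  have hev : ∀ᶠ B in nhds A, ∀ v ∈ Metric.sphere (0 : n → ℝ) 1, 0 < v ⬝ᵥ (B.1 *ᵥ v) := by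
    refine (isCompact_sphere (0 : n → ℝ) 1).eventually_forall_of_forall_eventually fun v hv => ?_
    have hv0 : v ≠ 0 := by
      rintro rfl
      simp at hv
    have hpos : 0 < v ⬝ᵥ (A.1 *ᵥ v) := by simpa using Matrix.PosDef.dotProduct_mulVec_pos hA hv0
    exact hcont.continuousAt.eventually (lt_mem_nhds hpos)
  filter_upwards [hev] with B hB
  refine PosDef.of_dotProduct_mulVec_pos ?_ fun {v} hv => ?_
  · change (B.1)ᴴ = _
    rw [conjTranspose_eq_transpose_of_trivial, Sym.transpose_eq]
  · have hn : 0 < ‖v‖ := norm_pos_iff.2 hv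
    have h := hB (‖v‖⁻¹ • v) (by simp [norm_smul, hn.ne'])
    rw [mulVec_smul, dotProduct_smul, smul_dotProduct, smul_eq_mul, smul_eq_mul, ← mul_assoc] at h
    simpa using pos_of_mul_pos_right h (by positivity)

/-- Its role is to make 𝒫 connected, so that the additive constant of a momentum map is global. -/
theorem convex_posDef {n : Type} : Convex ℝ {A : Sym n | (A : Matrix n n ℝ).PosDef} := by
  intro A hA B hB a b ha hb hab
  change ((a • A + b • B : Sym n) : Matrix n n ℝ).PosDef
  rw [Submodule.coe_add, Submodule.coe_smul, Submodule.coe_smul]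
  rcases ha.eq_or_lt with rfl | ha'
  · have : b = 1 := by linarith
    subst this
    simpa using hB
  · exact (PosDef.smul hA ha').add_posSemidef (PosSemidef.smul (PosDef.posSemidef hB) hb)

end MatrixCalculus

theorem isOpen_P (d : ℕ) : IsOpen (P d) :=
  isOpen_posDef.preimage (continuous_snd.comp continuous_snd)

theorem convex_P (d : ℕ) : Convex ℝ (P d) :=
  convex_posDef.linear_preimage (LinearMap.snd ℝ _ _ ∘ₗ LinearMap.snd ℝ _ _)

/-! ### The derivative of `σ` and the infinitesimal action of `sp(ℝ^{2d})` on `ℍ_d` -/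

theorem Sym2.toBlocks₁₁_transpose {d : ℕ} (ξ : Sym2 d) :
    (ξ.1.toBlocks₁₁)ᵀ = ξ.1.toBlocks₁₁ := by
  ext i j
  exact congrFun (congrFun (Sym.transpose_eq ξ) (Sum.inl i)) (Sum.inl j)

theorem Sym2.toBlocks₁₂_transpose {d : ℕ} (ξ : Sym2 d) :
    (ξ.1.toBlocks₁₂)ᵀ = ξ.1.toBlocks₂₁ := by
  ext i j
  exact congrFun (congrFun (Sym.transpose_eq ξ) (Sum.inr i)) (Sum.inl j)

theorem Sym2.toBlocks₂₁_transpose {d : ℕ} (ξ : Sym2 d) :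
    (ξ.1.toBlocks₂₁)ᵀ = ξ.1.toBlocks₁₂ := by
  ext i j
  exact congrFun (congrFun (Sym.transpose_eq ξ) (Sum.inl i)) (Sum.inr j)

theorem Sym2.toBlocks₂₂_transpose {d : ℕ} (ξ : Sym2 d) :
    (ξ.1.toBlocks₂₂)ᵀ = ξ.1.toBlocks₂₂ := by
  ext i j
  exact congrFun (congrFun (Sym.transpose_eq ξ) (Sum.inr i)) (Sum.inr j)

/-- The real and imaginary parts of `ξ₁₁ + ξ₁₂ 𝒞 + 𝒞 ξ₂₁ + 𝒞 ξ₂₂ 𝒞`, the generator of `ξ`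
on `ℍ_d`. -/
def siegelGen {d : ℕ} (ξ : Sym2 d) (c : SiegelModel d) : SiegelModel d :=
  (⟨ξ.1.toBlocks₁₁ + ξ.1.toBlocks₁₂ * c.1.1 + c.1.1 * ξ.1.toBlocks₂₁ +
      c.1.1 * ξ.1.toBlocks₂₂ * c.1.1 - c.2.1 * ξ.1.toBlocks₂₂ * c.2.1, by
      change (_ : Matrix _ _ ℝ)ᵀ = _
      simp only [transpose_add, transpose_sub, transpose_mul, Sym.transpose_eq,
        Sym2.toBlocks₁₁_transpose, Sym2.toBlocks₁₂_transpose, Sym2.toBlocks₂₁_transpose,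
        Sym2.toBlocks₂₂_transpose, Matrix.mul_assoc]
      abel⟩,
    ⟨ξ.1.toBlocks₁₂ * c.2.1 + c.2.1 * ξ.1.toBlocks₂₁ +
      c.1.1 * ξ.1.toBlocks₂₂ * c.2.1 + c.2.1 * ξ.1.toBlocks₂₂ * c.1.1, by
      change (_ : Matrix _ _ ℝ)ᵀ = _
      simp only [transpose_add, transpose_mul, Sym.transpose_eq,
        Sym2.toBlocks₁₂_transpose, Sym2.toBlocks₂₁_transpose,
        Sym2.toBlocks₂₂_transpose, Matrix.mul_assoc]
      abel⟩)

/-- The derivative of `σ` at `c` in the direction `v`. -/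
def dsigma {d : ℕ} (c v : SiegelModel d) : Sym2 d :=
  ⟨fromBlocks (-((c.2.1)⁻¹ * v.2.1 * (c.2.1)⁻¹))
      (-((c.2.1)⁻¹ * v.2.1 * (c.2.1)⁻¹) * c.1.1 + (c.2.1)⁻¹ * v.1.1)
      (v.1.1 * (c.2.1)⁻¹ + c.1.1 * -((c.2.1)⁻¹ * v.2.1 * (c.2.1)⁻¹))
      ((v.1.1 * (c.2.1)⁻¹ + c.1.1 * -((c.2.1)⁻¹ * v.2.1 * (c.2.1)⁻¹)) * c.1.1 +
        c.1.1 * (c.2.1)⁻¹ * v.1.1 + v.2.1), by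
    change (_ : Matrix _ _ ℝ)ᵀ = _
    simp only [fromBlocks_transpose, transpose_mul, transpose_add, transpose_neg,
      transpose_nonsing_inv, Sym.transpose_eq, Matrix.mul_assoc, Matrix.add_mul,
      Matrix.neg_mul, Matrix.mul_neg]
    congr 1 <;> abel⟩

theorem isUnit_det_of_mem_siegel {d : ℕ} {c : SiegelModel d} (hc : c ∈ siegel d) :
    IsUnit (c.2.1).det :=
  (Matrix.isUnit_iff_isUnit_det _).1 (Matrix.PosDef.isUnit hc)

theorem trace_fromBlocks_add {m n R : Type*} [Fintype m] [Fintype n] [AddCommMonoid R]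
    (A : Matrix m m R) (B : Matrix m n R) (C : Matrix n m R) (D : Matrix n n R) :
    trace (fromBlocks A B C D) = trace A + trace D := by
  simp [trace]

/-- The right side is the differential of 𝒞 ↦ tr(ξ σ(𝒞)), so this is the momentum map condition for
σ on (ℍ_d, Ω_ℍ). -/
theorem OmegaH_siegelGen {d : ℕ} {c : SiegelModel d} (hc : c ∈ siegel d) (ξ : Sym2 d)
    (v : SiegelModel d) : OmegaH c (siegelGen ξ c) v = trace (ξ.1 * (dsigma c v).1) := by
  have hu := isUnit_det_of_mem_siegel hc
  have l1 := fun X : Matrix (Fin d) (Fin d) ℝ => nonsing_inv_mul_cancel_left (c.2.1) X hu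
  have l2 := fun X : Matrix (Fin d) (Fin d) ℝ => mul_nonsing_inv_cancel_left (c.2.1) X hu
  have l3 := mul_nonsing_inv _ hu
  have e : ξ.1 = fromBlocks ξ.1.toBlocks₁₁ ξ.1.toBlocks₁₂ ξ.1.toBlocks₂₁ ξ.1.toBlocks₂₂ :=
    (fromBlocks_toBlocks _).symm
  rw [e]
  simp only [OmegaH, siegelGen, dsigma, fromBlocks_multiply, trace_fromBlocks_add]
  generalize ξ.1.toBlocks₁₁ = X at *
  generalize ξ.1.toBlocks₁₂ = Y at *
  generalize ξ.1.toBlocks₂₁ = Z at *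
  generalize ξ.1.toBlocks₂₂ = W at *
  generalize (c.2.1)⁻¹ = N at *
  generalize c.2.1 = B at *
  generalize c.1.1 = A at *
  generalize v.1.1 = a at *
  generalize v.2.1 = b at *
  -- After expansion both sides are sums of traces of words in the blocks. Cyclic rotation brings
  -- each word on the left to the form it has on the right; `r7` also cancels ℬℬ⁻¹.
  have r1 : trace (N * (Y * a)) = trace (Y * (a * N)) := by
    rw [trace_mul_comm, Matrix.mul_assoc]
  have r2 : trace (N * (A * (W * a))) = trace (W * (a * (N * A))) := by
    rw [← Matrix.mul_assoc, trace_mul_comm, Matrix.mul_assoc]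
  have r3 : trace (N * (b * (N * X))) = trace (X * (N * (b * N))) := by
    rw [trace_mul_comm X]; simp only [Matrix.mul_assoc]
  have r4 : trace (N * (b * (N * (Y * A)))) = trace (Y * (A * (N * (b * N)))) := by
    rw [← Matrix.mul_assoc Y A, trace_mul_comm (Y * A)]; simp only [Matrix.mul_assoc]
  have r5 : trace (N * (b * (N * (A * Z)))) = trace (Z * (N * (b * (N * A)))) := by
    rw [trace_mul_comm Z]; simp only [Matrix.mul_assoc]
  have r6 : trace (N * (b * (N * (A * (W * A))))) = trace (W * (A * (N * (b * (N * A))))) := by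
    rw [← Matrix.mul_assoc W A, trace_mul_comm (W * A)]; simp only [Matrix.mul_assoc]
  have r7 : trace (N * (b * (W * B))) = trace (W * b) := by
    rw [trace_mul_comm]; simp only [Matrix.mul_assoc, l3, Matrix.mul_one]
    rw [trace_mul_comm]
  simp only [Matrix.mul_add, Matrix.add_mul, Matrix.mul_sub, Matrix.mul_neg,
    Matrix.neg_mul, Matrix.mul_assoc, l1, l2, trace_add, trace_sub, trace_neg,
    r1, r2, r3, r4, r5, r6, r7]
  ring

/-- Infinitesimal equivariance of σ, checked block by block because it is what identifies the
generators later. The minus sign reflects ξ̃ = 𝕁ᵀξ = -𝕁ξ: ξ̃σ + σξ̃ᵀ = -(𝕁ξσ - σξ𝕁). -/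
theorem dsigma_siegelGen {d : ℕ} {c : SiegelModel d} (hc : c ∈ siegel d) (ξ : Sym2 d) :
    dsigma c (siegelGen ξ c) = -adStar ξ (sigma c) := by
  have hu := isUnit_det_of_mem_siegel hc
  have l1 := fun X : Matrix (Fin d) (Fin d) ℝ => nonsing_inv_mul_cancel_left (c.2.1) X hu
  have l3 := mul_nonsing_inv _ hu
  have e : ξ.1 = fromBlocks ξ.1.toBlocks₁₁ ξ.1.toBlocks₁₂ ξ.1.toBlocks₂₁ ξ.1.toBlocks₂₂ :=
    (fromBlocks_toBlocks _).symm
  apply Subtype.ext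
  rw [Submodule.coe_neg]
  simp only [adStar]
  rw [e]
  simp only [siegelGen, dsigma, sigma, JJ, fromBlocks_multiply, fromBlocks_neg, sub_eq_add_neg,
    fromBlocks_add]
  generalize ξ.1.toBlocks₁₁ = X at *
  generalize ξ.1.toBlocks₁₂ = Y at *
  generalize ξ.1.toBlocks₂₁ = Z at *
  generalize ξ.1.toBlocks₂₂ = W at *
  generalize (c.2.1)⁻¹ = N at *
  generalize c.2.1 = B at *
  generalize c.1.1 = A at *
  simp only [Matrix.mul_add, Matrix.add_mul, Matrix.mul_neg, Matrix.zero_mul, Matrix.one_mul,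
    Matrix.mul_zero, Matrix.mul_one,
    Matrix.neg_mul, Matrix.mul_assoc, l1, l3]
  congr 1 <;> abel

/-- Infinitesimal transitivity. With ξ₂₂ = 0 and ξ₁₂ = Y the imaginary part of the generator is Yℬ +
ℬYᵀ, which equals the prescribed u₂ for Y = ½u₂ℬ⁻¹; the block ξ₁₁ enters only the real part,
additively, and corrects it. -/
theorem exists_siegelGen_eq {d : ℕ} {c : SiegelModel d} (hc : c ∈ siegel d) (u : SiegelModel d) :
    ∃ ξ : Sym2 d, siegelGen ξ c = u := by
  have hu := isUnit_det_of_mem_siegel hc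
  have l2 := fun X : Matrix (Fin d) (Fin d) ℝ => mul_nonsing_inv_cancel_left (c.2.1) X hu
  have l4 := nonsing_inv_mul _ hu
  let Y : Matrix (Fin d) (Fin d) ℝ := (1 / 2 : ℝ) • (u.2.1 * (c.2.1)⁻¹)
  have hY : Yᵀ = (1 / 2 : ℝ) • ((c.2.1)⁻¹ * u.2.1) := by
    simp only [Y, transpose_smul, transpose_mul, transpose_nonsing_inv, Sym.transpose_eq]
  refine ⟨⟨fromBlocks (u.1.1 - Y * c.1.1 - c.1.1 * Yᵀ) Y Yᵀ 0, ?_⟩, ?_⟩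
  · change (_ : Matrix _ _ ℝ)ᵀ = _
    simp only [fromBlocks_transpose, transpose_sub, transpose_mul, transpose_transpose,
      Sym.transpose_eq, transpose_zero]
    congr 1
    abel
  · refine Prod.ext (Subtype.ext ?_) (Subtype.ext ?_)
    · simp only [siegelGen, toBlocks_fromBlocks₁₁, toBlocks_fromBlocks₁₂, toBlocks_fromBlocks₂₁,
        toBlocks_fromBlocks₂₂, Matrix.mul_zero, Matrix.zero_mul]
      abel
    · simp only [siegelGen, toBlocks_fromBlocks₁₁, toBlocks_fromBlocks₁₂, toBlocks_fromBlocks₂₁,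
        toBlocks_fromBlocks₂₂, Matrix.mul_zero, Matrix.zero_mul, hY]
      simp only [Y, Matrix.smul_mul, Matrix.mul_smul, Matrix.mul_assoc, l2, l4, Matrix.mul_one,
        add_zero, ← add_smul]
      norm_num

/-- The upper left block determines the ℬ-component, and the upper right block then determines the
𝒜-component. -/
theorem dsigma_injective {d : ℕ} {c : SiegelModel d} (hc : c ∈ siegel d) {u v : SiegelModel d}
    (h : dsigma c u = dsigma c v) : u = v := by
  have hu := isUnit_det_of_mem_siegel hc
  have h1 := congrArg (fun A => A.1.toBlocks₁₁) h
  have h2 := congrArg (fun A => A.1.toBlocks₁₂) h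
  simp only [dsigma, toBlocks_fromBlocks₁₁, toBlocks_fromBlocks₁₂] at h1 h2
  rw [h1, add_right_inj] at h2
  rw [neg_inj] at h1
  have h3 := congrArg (fun X => c.2.1 * (X * c.2.1)) h1
  simp only [Matrix.mul_assoc, nonsing_inv_mul _ hu, Matrix.mul_one,
    mul_nonsing_inv_cancel_left _ _ hu] at h3
  have h4 := congrArg (fun X => c.2.1 * X) h2
  simp only [mul_nonsing_inv_cancel_left _ _ hu] at h4
  exact Prod.ext (Subtype.ext h4) (Subtype.ext h3)

theorem contDiffAt_sigma {d : ℕ} {r : WithTop ℕ∞} {c : SiegelModel d} (hc : c ∈ siegel d) :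
    ContDiffAt ℝ r sigma c := by
  have hu := isUnit_det_of_mem_siegel hc
  have hA : ContDiffAt ℝ r (fun y : SiegelModel d => y.1.1) c :=
    ((contDiff_sym_coe (n := Fin d)).comp contDiff_fst).contDiffAt
  have hB : ContDiffAt ℝ r (fun y : SiegelModel d => y.2.1) c :=
    ((contDiff_sym_coe (n := Fin d)).comp contDiff_snd).contDiffAt
  have hN := contDiffAt_matrix_inv hB hu
  have h12 := contDiffAt_matrix_mul hN hA
  have h21 := contDiffAt_matrix_mul hA hN
  have h22 := (contDiffAt_matrix_mul h21 hA).add hB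
  rw [contDiffAt_sym, contDiffAt_matrix]
  rintro (i | i) (j | j)
  · exact contDiffAt_matrix.1 hN i j
  · exact contDiffAt_matrix.1 h12 i j
  · exact contDiffAt_matrix.1 h21 i j
  · exact contDiffAt_matrix.1 h22 i j

theorem hasDerivAt_sigma_comp {d : ℕ} {f : ℝ → SiegelModel d} {f' : SiegelModel d} {t : ℝ}
    (hf : HasDerivAt f f' t) (ht : f t ∈ siegel d) :
    HasDerivAt (fun s => sigma (f s)) (dsigma (f t) f') t := by
  have hu := isUnit_det_of_mem_siegel ht
  have hA : HasDerivAt (fun s => (f s).1.1) f'.1.1 t :=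
    hasDerivAt_sym.1
      ((ContinuousLinearMap.fst ℝ (Sym (Fin d)) (Sym (Fin d))).hasFDerivAt.comp_hasDerivAt t hf :)
  have hB : HasDerivAt (fun s => (f s).2.1) f'.2.1 t :=
    hasDerivAt_sym.1
      ((ContinuousLinearMap.snd ℝ (Sym (Fin d)) (Sym (Fin d))).hasFDerivAt.comp_hasDerivAt t hf :)
  have hN := hasDerivAt_matrix_inv hB hu
  have h12 := hasDerivAt_matrix_mul hN hA
  have h21 := hasDerivAt_matrix_mul hA hN
  have h22 := (hasDerivAt_matrix_mul h21 hA).add hB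
  rw [hasDerivAt_sym, hasDerivAt_matrix]
  rintro (i | i) (j | j)
  · exact hasDerivAt_matrix.1 hN i j
  · exact hasDerivAt_matrix.1 h12 i j
  · exact hasDerivAt_matrix.1 h21 i j
  · exact hasDerivAt_matrix.1 h22 i j

theorem fderiv_sigma {d : ℕ} {c : SiegelModel d} (hc : c ∈ siegel d) (v : SiegelModel d) :
    fderiv ℝ sigma c v = dsigma c v := by
  have hd : DifferentiableAt ℝ (sigma (d := d)) c :=
    (contDiffAt_sigma (r := 1) hc).differentiableAt (by simp)
  have hl : HasDerivAt (fun t : ℝ => c + t • v) v 0 := by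
    have := ((hasDerivAt_id (0 : ℝ)).smul_const v).const_add c
    rwa [one_smul] at this
  have e : c + (0 : ℝ) • v = c := by simp
  have h1 := HasFDerivAt.comp_hasDerivAt_of_eq (0 : ℝ) hd.hasFDerivAt hl e.symm
  have h2 := hasDerivAt_sigma_comp hl (by rwa [e])
  rw [e] at h2
  exact h1.unique h2

theorem contDiffAt_M {d : ℕ} {r : WithTop ℕ∞} {x : PModel d} (hx : x ∈ P d) :
    ContDiffAt ℝ r M x :=
  contDiffAt_fst.prodMk ((contDiffAt_sigma hx).comp x contDiffAt_snd)

theorem differentiableAt_M {d : ℕ} {x : PModel d} (hx : x ∈ P d) : DifferentiableAt ℝ M x :=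
  (contDiffAt_M (r := 1) hx).differentiableAt (by simp)

theorem fderiv_M {d : ℕ} {x : PModel d} (hx : x ∈ P d) (v : PModel d) :
    fderiv ℝ M x v = (v.1, dsigma x.2 v.2) := by
  have hd : DifferentiableAt ℝ (sigma (d := d)) x.2 :=
    (contDiffAt_sigma (r := 1) hx).differentiableAt (by simp)
  have h : HasFDerivAt (M (d := d)) _ x :=
    hasFDerivAt_fst.prodMk (hd.hasFDerivAt.comp x hasFDerivAt_snd)
  rw [h.fderiv, ← fderiv_sigma hx]
  rfl

/-! ### The action on `ℍ_d` and the equivariance of `σ` -/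

theorem toComplex_Phi {d : ℕ} (S : Matrix.symplecticGroup (Fin d) ℝ) (c : siegel d) :
    toComplex (Phi S c).1 = mobius S.1 c.1 := by
  ext i j
  simp only [toComplex, Phi, Matrix.add_apply, Matrix.smul_apply, map_apply, smul_eq_mul]
  rw [mul_comm]
  exact Complex.re_add_im _

theorem toComplex_injective {d : ℕ} : Function.Injective (toComplex (d := d)) := by
  intro c c' h
  refine Prod.ext (Subtype.ext ?_) (Subtype.ext ?_) <;> ext i j
  · simpa [toComplex] using congrArg Complex.re (congrFun (congrFun h i) j)
  · simpa [toComplex] using congrArg Complex.im (congrFun (congrFun h i) j)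

/-- The matrix with the blocks `I` and `𝒞`, whose columns span the Lagrangian subspace of `𝒞`. -/
def frame {d : ℕ} (c : SiegelModel d) : Matrix (Fin d ⊕ Fin d) (Fin d) ℂ :=
  fromRows 1 (toComplex c)

theorem map_ofReal_mul {l m n : Type*} [Fintype m] (A : Matrix l m ℝ) (B : Matrix m n ℝ) :
    (A * B).map Complex.ofReal = A.map Complex.ofReal * B.map Complex.ofReal :=
  Matrix.map_mul (f := Complex.ofRealHom)

theorem map_ofReal_one {n : Type*} [DecidableEq n] :
    (1 : Matrix n n ℝ).map Complex.ofReal = 1 :=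
  Matrix.map_one _ (by simp) (by simp)

theorem map_mul_frame {d : ℕ} (S : Matrix (Fin d ⊕ Fin d) (Fin d ⊕ Fin d) ℝ)
    (c : SiegelModel d) :
    S.map Complex.ofReal * frame c = fromRows (denom S c) (numer S c) := by
  conv_lhs => rw [← fromBlocks_toBlocks S, fromBlocks_map, frame, fromBlocks_mul_fromRows]
  simp only [Matrix.mul_one, denom, numer]

/-- The Möbius formula is linear action on frames followed by normalizing the upper block to I. The
group laws for Φ and the equivariance of σ thereby reduce to associativity of matrix products. -/
theorem map_mul_frame_symplectic {d : ℕ} (S : Matrix.symplecticGroup (Fin d) ℝ) (c : siegel d) :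
    S.1.map Complex.ofReal * frame c.1 = frame (Phi S c).1 * denom S.1 c.1 := by
  have hd : IsUnit (denom S.1 c.1).det :=
    (Matrix.isUnit_iff_isUnit_det _).1 (denom_isUnit S c.1 c.2)
  rw [map_mul_frame, frame, fromRows_mul, toComplex_Phi, mobius, Matrix.one_mul,
    nonsing_inv_mul_cancel_right _ _ hd]

/-- A Lagrangian subspace determines its normalized frame: the upper blocks force D = D', which then
cancels from the lower blocks. -/
theorem eq_of_frame_mul_eq {d : ℕ} {c c' : SiegelModel d} {D D' : Matrix (Fin d) (Fin d) ℂ}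
    (hD : IsUnit D) (h : frame c * D = frame c' * D') : c = c' := by
  simp only [frame, fromRows_mul, Matrix.one_mul, fromRows_ext_iff] at h
  obtain ⟨rfl, h⟩ := h
  exact toComplex_injective (hD.mul_left_injective h)

theorem Phi_one {d : ℕ} (c : siegel d) : Phi 1 c = c := by
  apply Subtype.ext
  refine (eq_of_frame_mul_eq (D := 1) (D' := denom (1 : symplecticGroup (Fin d) ℝ).1 c.1)
    isUnit_one ?_).symm
  rw [← map_mul_frame_symplectic]
  rw [OneMemClass.coe_one, map_ofReal_one, Matrix.one_mul, Matrix.mul_one]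

theorem Phi_mul {d : ℕ} (S S' : Matrix.symplecticGroup (Fin d) ℝ) (c : siegel d) :
    Phi (S * S') c = Phi S (Phi S' c) := by
  apply Subtype.ext
  refine eq_of_frame_mul_eq (D := denom (S * S').1 c.1)
    (D' := denom S.1 (Phi S' c).1 * denom S'.1 c.1) (denom_isUnit _ _ c.2) ?_
  rw [← map_mul_frame_symplectic, ← Matrix.mul_assoc, ← map_mul_frame_symplectic,
    Matrix.mul_assoc, ← map_mul_frame_symplectic, ← Matrix.mul_assoc, ← map_ofReal_mul]
  rfl

theorem Psi_one {d : ℕ} (x : P d) : Psi 1 x = x := by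
  apply Subtype.ext
  refine Prod.ext ?_ ?_
  · change x.1.1 + JJ d *ᵥ 0 = x.1.1
    rw [mulVec_zero, add_zero]
  · exact congrArg Subtype.val (Phi_one ⟨x.1.2, x.2⟩)

theorem Psi_mul {d : ℕ} (g g' : G d) (x : P d) : Psi (g * g') x = Psi g (Psi g' x) := by
  apply Subtype.ext
  refine Prod.ext ?_ ?_
  · change x.1.1 + JJ d *ᵥ (g.1.toAdd + g'.1.toAdd) =
      x.1.1 + JJ d *ᵥ g'.1.toAdd + JJ d *ᵥ g.1.toAdd
    rw [mulVec_add]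
    abel
  · exact congrArg Subtype.val (Phi_mul g.2 g'.2 ⟨x.1.2, x.2⟩)

/-- `[I; 𝒞] ℬ⁻¹ [I; 𝒞]ᴴ = σ(𝒞) - i𝕁`. -/
theorem frame_mul_conjTranspose {d : ℕ} {c : SiegelModel d} (hc : c ∈ siegel d) :
    frame c * ((c.2.1)⁻¹).map Complex.ofReal * (frame c)ᴴ =
      (sigma c).1.map Complex.ofReal - Complex.I • (JJ d).map Complex.ofReal := by
  have hu := isUnit_det_of_mem_siegel hc
  have hNB : ((c.2.1)⁻¹).map Complex.ofReal * (c.2.1).map Complex.ofReal = 1 := by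
    rw [← map_ofReal_mul, nonsing_inv_mul _ hu, map_ofReal_one]
  have hBN : (c.2.1).map Complex.ofReal * ((c.2.1)⁻¹).map Complex.ofReal = 1 := by
    rw [← map_ofReal_mul, mul_nonsing_inv _ hu, map_ofReal_one]
  have hadd : ∀ X Y : Matrix (Fin d) (Fin d) ℝ, (X + Y).map Complex.ofReal =
      X.map Complex.ofReal + Y.map Complex.ofReal := fun X Y => by ext i j; simp
  have hneg : (-1 : Matrix (Fin d) (Fin d) ℝ).map Complex.ofReal = -1 := by
    ext i j; simp [Matrix.one_apply, apply_ite Complex.ofReal]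
  have hzero : (0 : Matrix (Fin d) (Fin d) ℝ).map Complex.ofReal = 0 := by ext i j; simp
  rw [frame, conjTranspose_fromRows_eq_fromCols_conjTranspose, fromRows_mul,
    fromRows_mul_fromCols, toComplex_conjTranspose, sigma, JJ, fromBlocks_map, fromBlocks_map,
    fromBlocks_smul, sub_eq_add_neg (fromBlocks _ _ _ _), fromBlocks_neg, fromBlocks_add, toComplex]
  simp only [conjTranspose_one, Matrix.mul_one, Matrix.one_mul, map_ofReal_mul, map_ofReal_one,
    hadd, hneg, hzero, smul_zero, neg_zero, add_zero, sub_eq_add_neg, Matrix.add_mul,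
    Matrix.mul_add, Matrix.smul_mul, Matrix.mul_smul, Matrix.mul_neg, hNB, hBN,
    Matrix.mul_assoc, smul_add, smul_neg, smul_smul, Complex.I_mul_I, neg_smul, one_smul, neg_neg]
  congr 1
  abel

/-- Put D = S₁₁ + S₁₂𝒞 and let ℬ' be the imaginary part of Φ_S(𝒞). Since S[I; 𝒞] = [I; Φ_S(𝒞)]D and
ℬ'⁻¹ = Dℬ⁻¹Dᴴ, conjugating σ(𝒞) - i𝕁 by S gives σ(Φ_S(𝒞)) - i𝕁. -/
theorem sigma_Phi {d : ℕ} (S : Matrix.symplecticGroup (Fin d) ℝ) (c : siegel d) :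
    sigma (Phi S c).1 = coAd S (sigma c.1) := by
  have hd : IsUnit (denom S.1 c.1).det :=
    (Matrix.isUnit_iff_isUnit_det _).1 (denom_isUnit S c.1 c.2)
  have hdH : IsUnit (denom S.1 c.1)ᴴ.det := by
    rw [det_conjTranspose]; exact hd.star
  have hu := isUnit_det_of_mem_siegel c.2
  have hu' := isUnit_det_of_mem_siegel (Phi S c).2
  -- The inverse of the transformation law `mobius_im`, obtained by uniqueness of inverses.
  have hN : (((Phi S c).1.2.1)⁻¹).map Complex.ofReal =
      denom S.1 c.1 * ((c.1.2.1)⁻¹).map Complex.ofReal * (denom S.1 c.1)ᴴ := by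
    have h1 : ((Phi S c).1.2.1).map Complex.ofReal *
        (((Phi S c).1.2.1)⁻¹).map Complex.ofReal = 1 := by
      rw [← map_ofReal_mul, mul_nonsing_inv _ hu', map_ofReal_one]
    have h2 : (denom S.1 c.1 * ((c.1.2.1)⁻¹).map Complex.ofReal * (denom S.1 c.1)ᴴ) *
        ((Phi S c).1.2.1).map Complex.ofReal = 1 := by
      change _ * ((mobius S.1 c.1).map Complex.im).map Complex.ofReal = 1
      have hNB : ((c.1.2.1)⁻¹).map Complex.ofReal * (c.1.2.1).map Complex.ofReal = 1 := by
        rw [← map_ofReal_mul, nonsing_inv_mul _ hu, map_ofReal_one]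
      rw [mobius_im S c.1 c.2, conjTranspose_nonsing_inv]
      simp only [Matrix.mul_assoc]
      rw [mul_nonsing_inv_cancel_left _ _ hdH, ← Matrix.mul_assoc (((c.1.2.1)⁻¹).map _), hNB,
        Matrix.one_mul, mul_nonsing_inv _ hd]
    exact (left_inv_eq_right_inv h2 h1).symm
  have key : (sigma (Phi S c).1).1.map Complex.ofReal - Complex.I • (JJ d).map Complex.ofReal =
      S.1.map Complex.ofReal *
        ((sigma c.1).1.map Complex.ofReal - Complex.I • (JJ d).map Complex.ofReal) *
        S.1ᵀ.map Complex.ofReal := by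
    have hST : S.1ᵀ.map Complex.ofReal = (S.1.map Complex.ofReal)ᴴ := by
      ext i j; simp
    rw [← frame_mul_conjTranspose (Phi S c).2, ← frame_mul_conjTranspose c.2, hN, hST]
    have e := map_mul_frame_symplectic S c
    calc frame (Phi S c).1 * (denom S.1 c.1 * ((c.1.2.1)⁻¹).map Complex.ofReal *
            (denom S.1 c.1)ᴴ) * (frame (Phi S c).1)ᴴ
        = (frame (Phi S c).1 * denom S.1 c.1) * ((c.1.2.1)⁻¹).map Complex.ofReal *
            (frame (Phi S c).1 * denom S.1 c.1)ᴴ := by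
          simp only [conjTranspose_mul, Matrix.mul_assoc]
      _ = _ := by
          rw [← e]
          simp only [conjTranspose_mul, Matrix.mul_assoc]
  apply Subtype.ext
  ext i j
  -- The 𝕁-terms on both sides are purely imaginary and disappear in the real part.
  have hre := congrArg Complex.re (congrFun (congrFun key i) j)
  rw [Matrix.mul_sub, Matrix.sub_mul, Matrix.mul_smul, Matrix.smul_mul, ← map_ofReal_mul,
    ← map_ofReal_mul, ← map_ofReal_mul, ← map_ofReal_mul] at hre
  simpa [coAd] using hre

theorem M_Psi {d : ℕ} (g : G d) (x : P d) : M (Psi g x).1 = momentAct g (M x.1) :=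
  Prod.ext rfl (sigma_Phi g.2 ⟨x.1.2, x.2⟩)

/-! ### The infinitesimal generators -/

/-- The exponential series is differentiated in a normed algebra, so a submultiplicative operator
norm replaces the entrywise sup norm inside the proof; the derivative depends only on the topology,
which is the same. -/
theorem hasDerivAt_exp_smul_matrix {n : Type} [Fintype n] [DecidableEq n] (A : Matrix n n ℝ) :
    HasDerivAt (fun t : ℝ => NormedSpace.exp (t • A)) A 0 := by
  let : NormedRing (Matrix n n ℝ) := Matrix.linftyOpNormedRing
  let : NormedAlgebra ℝ (Matrix n n ℝ) := Matrix.linftyOpNormedAlgebra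
  have : @CompleteSpace (Matrix n n ℝ)
      Matrix.linftyOpNormedRing.toPseudoMetricSpace.toUniformSpace :=
    FiniteDimensional.complete ℝ (Matrix n n ℝ)
  have h := hasDerivAt_exp_smul_const (𝕂 := ℝ) A 0
  rw [zero_smul, NormedSpace.exp_zero, one_mul] at h
  exact h

theorem hasDerivAt_coAd_exp {d : ℕ} (ξ μ : Sym2 d) :
    HasDerivAt (fun t : ℝ => coAd ⟨NormedSpace.exp (tilde (t • ξ)), exp_tilde_mem (t • ξ)⟩ μ)
      (-adStar ξ μ) 0 := by
  have e : (fun t : ℝ => NormedSpace.exp (tilde (t • ξ))) =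
      fun t : ℝ => NormedSpace.exp (t • tilde ξ) := by
    funext t
    simp only [tilde, Submodule.coe_smul, Matrix.mul_smul]
  have hS : HasDerivAt (fun t : ℝ => NormedSpace.exp (tilde (t • ξ))) (tilde ξ) 0 := by
    rw [e]
    exact hasDerivAt_exp_smul_matrix _
  have h0 : NormedSpace.exp (tilde ((0 : ℝ) • ξ)) = 1 := by
    rw [congrFun e 0, zero_smul, NormedSpace.exp_zero]
  have h := hasDerivAt_matrix_mul (hasDerivAt_matrix_mul hS (hasDerivAt_const (0 : ℝ) μ.1))
    (hasDerivAt_matrix_transpose hS)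
  rw [hasDerivAt_sym]
  refine h.congr_deriv ?_
  rw [h0]
  simp only [tilde, Submodule.coe_neg, adStar, transpose_one, transpose_mul, transpose_neg,
    Matrix.mul_neg, neg_neg, Sym.transpose_eq, JJ_transpose, Matrix.mul_one, Matrix.one_mul,
    Matrix.mul_zero, add_zero, Matrix.neg_mul, neg_sub, Matrix.mul_assoc]
  abel

/-- An explicit left inverse of σ, built from matrix inversion and multiplication. It yields
injectivity and lets differentiability pass from σ ∘ f back to f. -/
theorem siegel_eq_of_sigma {d : ℕ} {c : SiegelModel d} (hc : c ∈ siegel d) :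
    c.2.1 = ((sigma c).1.toBlocks₁₁)⁻¹ ∧
      c.1.1 = ((sigma c).1.toBlocks₁₁)⁻¹ * (sigma c).1.toBlocks₁₂ := by
  have hu := isUnit_det_of_mem_siegel hc
  simp only [sigma, toBlocks_fromBlocks₁₁, toBlocks_fromBlocks₁₂, nonsing_inv_nonsing_inv _ hu,
    mul_nonsing_inv_cancel_left _ _ hu, and_self]

theorem sigma_injOn {d : ℕ} : Set.InjOn (sigma (d := d)) (siegel d) := by
  intro c hc c' hc' h
  obtain ⟨h1, h2⟩ := siegel_eq_of_sigma hc
  obtain ⟨h1', h2'⟩ := siegel_eq_of_sigma hc'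
  refine Prod.ext (Subtype.ext ?_) (Subtype.ext ?_)
  · rw [h2, h2', h]
  · rw [h1, h1', h]

/-- A curve in `ℍ_d` is differentiable if its image under `σ` is. -/
theorem hasDerivAt_of_sigma_comp {d : ℕ} {f : ℝ → SiegelModel d} {f' : SiegelModel d} {t : ℝ}
    (hf : ∀ s, f s ∈ siegel d) (h : HasDerivAt (fun s => sigma (f s)) (dsigma (f t) f') t) :
    HasDerivAt f f' t := by
  have h' := hasDerivAt_matrix.1 (hasDerivAt_sym.1 h)
  have h11 : HasDerivAt (fun s => (sigma (f s)).1.toBlocks₁₁) (dsigma (f t) f').1.toBlocks₁₁ t :=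
    hasDerivAt_matrix.2 fun i j => h' (Sum.inl i) (Sum.inl j)
  have h12 : HasDerivAt (fun s => (sigma (f s)).1.toBlocks₁₂) (dsigma (f t) f').1.toBlocks₁₂ t :=
    hasDerivAt_matrix.2 fun i j => h' (Sum.inl i) (Sum.inr j)
  have hu : IsUnit ((sigma (f t)).1.toBlocks₁₁).det := by
    simp only [sigma, toBlocks_fromBlocks₁₁]
    exact Matrix.isUnit_nonsing_inv_det _ (isUnit_det_of_mem_siegel (hf t))
  have hN := hasDerivAt_matrix_inv h11 hu
  have hA := hasDerivAt_matrix_mul hN h12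
  have hd : DifferentiableAt ℝ f t := by
    refine DifferentiableAt.prodMk (f₁ := fun s => (f s).1) (f₂ := fun s => (f s).2)
      (differentiableAt_sym ?_) (differentiableAt_sym ?_)
    · simp only [fun s => (siegel_eq_of_sigma (hf s)).2]
      exact hA.differentiableAt
    · simp only [fun s => (siegel_eq_of_sigma (hf s)).1]
      exact hN.differentiableAt
  -- So far f is only known to have some derivative; injectivity of dσ identifies it with f'.
  have := hasDerivAt_sigma_comp hd.hasDerivAt (hf t)
  rw [← dsigma_injective (hf t) (this.unique h)]
  exact hd.hasDerivAt

/-- The curve Φ_{exp(tξ̃)}(𝒞) is not differentiated directly. By equivariance σ maps it to exp(tξ̃)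
σ exp(tξ̃)ᵀ, whose derivative -ad*_ξ σ is dσ(ξ_ℍ). -/
theorem hasDerivAt_orbitCurve {d : ℕ} (a : PhaseSpace d × Sym2 d) (x : P d) :
    HasDerivAt (orbitCurve a x) (JJ d *ᵥ a.1, siegelGen a.2 x.1.2) 0 := by
  have h0 : ∀ ξ : Sym2 d, (⟨NormedSpace.exp (tilde ((0 : ℝ) • ξ)), exp_tilde_mem ((0 : ℝ) • ξ)⟩ :
      Matrix.symplecticGroup (Fin d) ℝ) = 1 := by
    intro ξ
    apply Subtype.ext
    simp [tilde, NormedSpace.exp_zero]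
  have hz : HasDerivAt (fun t : ℝ => x.1.1 + JJ d *ᵥ (t • a.1)) (JJ d *ᵥ a.1) 0 := by
    simp only [mulVec_smul]
    have := ((hasDerivAt_id (0 : ℝ)).smul_const (JJ d *ᵥ a.1)).const_add x.1.1
    rwa [one_smul] at this
  let c : siegel d := ⟨x.1.2, x.2⟩
  let f : ℝ → SiegelModel d := fun t =>
    (Phi ⟨NormedSpace.exp (tilde (t • a.2)), exp_tilde_mem (t • a.2)⟩ c).1
  have hf0 : f 0 = x.1.2 := by
    simp only [f, h0, Phi_one]
    rfl
  have hf : HasDerivAt f (siegelGen a.2 x.1.2) 0 := by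
    refine hasDerivAt_of_sigma_comp (fun s => (Phi _ c).2) ?_
    rw [hf0, dsigma_siegelGen x.2]
    simp only [f, sigma_Phi]
    exact hasDerivAt_coAd_exp a.2 (sigma x.1.2)
  exact hz.prodMk hf

theorem infGen_eq {d : ℕ} (a : PhaseSpace d × Sym2 d) (x : P d) :
    infGen a x = (JJ d *ᵥ a.1, siegelGen a.2 x.1.2) :=
  (hasDerivAt_orbitCurve a x).deriv

/-! ### The image of `σ` is one coadjoint orbit -/

theorem coAd_one {d : ℕ} (μ : Sym2 d) : coAd 1 μ = μ := by
  apply Subtype.ext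
  simp [coAd]

theorem coAd_mul {d : ℕ} (S S' : Matrix.symplecticGroup (Fin d) ℝ) (μ : Sym2 d) :
    coAd (S * S') μ = coAd S (coAd S' μ) := by
  apply Subtype.ext
  simp only [coAd, Submonoid.coe_mul, transpose_mul, Matrix.mul_assoc]

open scoped MatrixOrder in
theorem exists_mul_transpose_of_posDef {n : Type} [Fintype n] [DecidableEq n] {B : Matrix n n ℝ}
    (hB : B.PosDef) : ∃ R : Matrix n n ℝ, IsUnit R.det ∧ B = R * Rᵀ := by
  obtain ⟨y, hy⟩ := CStarAlgebra.nonneg_iff_eq_star_mul_self.mp hB.posSemidef.nonneg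
  rw [star_eq_conjTranspose, conjTranspose_eq_transpose_of_trivial] at hy
  have hu : IsUnit B.det := (Matrix.isUnit_iff_isUnit_det _).1 hB.isUnit
  refine ⟨yᵀ, ?_, by rw [transpose_transpose, hy]⟩
  rw [hy, det_mul] at hu
  exact isUnit_of_mul_isUnit_left hu

/-- The unit of `sym(2d, ℝ)`, which is `σ(iI)`. -/
def symOne (d : ℕ) : Sym2 d := ⟨1, transpose_one⟩

/-- With ℬ = RRᵀ, the shear [[I, 0], [𝒜, I]] times diag(R⁻ᵀ, R) is a symplectic S with SSᵀ = σ(𝒞).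
Hence all covariance matrices lie on the orbit of the identity matrix. -/
theorem exists_coAd_symOne_eq_sigma {d : ℕ} {c : SiegelModel d} (hc : c ∈ siegel d) :
    ∃ S, coAd S (symOne d) = sigma c := by
  obtain ⟨R, hR, hB⟩ := exists_mul_transpose_of_posDef (B := c.2.1) hc
  have hN : (c.2.1)⁻¹ = (Rᵀ)⁻¹ * R⁻¹ := by rw [hB, Matrix.mul_inv_rev]
  refine ⟨⟨fromBlocks (Rᵀ)⁻¹ 0 (c.1.1 * (Rᵀ)⁻¹) R, ?_⟩, ?_⟩
  · rw [SymplecticGroup.fromBlocks_mem_iff]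
    simp only [transpose_mul, transpose_nonsing_inv, transpose_transpose, Sym.transpose_eq,
      transpose_zero, Matrix.zero_mul, Matrix.mul_zero, sub_zero, Matrix.mul_assoc,
      nonsing_inv_mul _ hR, and_self]
  · apply Subtype.ext
    simp only [coAd, symOne, sigma, Matrix.mul_one, fromBlocks_transpose, fromBlocks_multiply,
      transpose_mul, transpose_nonsing_inv, transpose_transpose, Sym.transpose_eq,
      transpose_zero, Matrix.zero_mul, Matrix.mul_zero, add_zero, Matrix.mul_assoc, hN]
    rw [← hB]

theorem sigma_mem_coadjointOrbit {d : ℕ} {c c' : SiegelModel d} {μ : Sym2 d} (hc : c ∈ siegel d)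
    (hc' : c' ∈ siegel d) (h : sigma c ∈ coadjointOrbit μ) : sigma c' ∈ coadjointOrbit μ := by
  obtain ⟨S, hS⟩ := exists_coAd_symOne_eq_sigma hc
  obtain ⟨S', hS'⟩ := exists_coAd_symOne_eq_sigma hc'
  obtain ⟨T, hT⟩ := h
  -- T carries μ to σ(c), S⁻¹ carries that to the identity matrix, and S' carries the identity to
  -- σ(c').
  refine ⟨S' * (S⁻¹ * T), ?_⟩
  change coAd T μ = _ at hT
  change coAd _ μ = _
  rw [coAd_mul, coAd_mul, hT, ← hS, ← coAd_mul S⁻¹, inv_mul_cancel, coAd_one, hS']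

/-- A point S σ(c) Sᵀ of the orbit is σ(Φ_S(c)) by equivariance, so M is onto ℝ^{2d} × 𝒪. -/
theorem exists_M_eq {d : ℕ} {c : SiegelModel d} (hc : c ∈ siegel d) {w : Moments d}
    (hw : w.2 ∈ coadjointOrbit (sigma c)) : ∃ x ∈ P d, M x = w := by
  obtain ⟨S, hS⟩ := hw
  exact ⟨(w.1, (Phi S ⟨c, hc⟩).1), (Phi S ⟨c, hc⟩).2, Prod.ext rfl ((sigma_Phi S ⟨c, hc⟩).trans hS)⟩

theorem M_injOn {d : ℕ} : Set.InjOn (M (d := d)) (P d) := fun _ hx _ hy hxy =>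
  Prod.ext (congrArg Prod.fst hxy :) (sigma_injOn hx hy (congrArg Prod.snd hxy :))

/-! ### The pull-back of `ω` -/

theorem adStar_smul {d : ℕ} (r : ℝ) (ξ μ : Sym2 d) : adStar (r • ξ) μ = r • adStar ξ μ := by
  apply Subtype.ext
  simp only [adStar, Submodule.coe_smul, Matrix.mul_smul, Matrix.smul_mul, smul_sub]

theorem adStar_neg {d : ℕ} (ξ μ : Sym2 d) : adStar (-ξ) μ = -adStar ξ μ := by
  apply Subtype.ext
  simp only [adStar, Submodule.coe_neg, Matrix.mul_neg, Matrix.neg_mul, neg_sub_neg, neg_sub]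

/-- Writing u = ξ_ℍ and v = η_ℍ, one has Ω_ℍ(ξ_ℍ, η_ℍ) = tr(ξ dσ(η_ℍ)) = -tr(ξ ad*_η σ) = tr(σ[ξ,
η]); the two minus signs in dσ cancel in the orbit form. -/
theorem kks_dsigma {d : ℕ} {c : SiegelModel d} (hc : c ∈ siegel d) (u v : SiegelModel d) :
    kks (sigma c) (dsigma c u) (dsigma c v) = OmegaH c u v := by
  obtain ⟨ξ, rfl⟩ := exists_siegelGen_eq hc u
  obtain ⟨η, rfl⟩ := exists_siegelGen_eq hc v
  rw [OmegaH_siegelGen hc, dsigma_siegelGen hc, dsigma_siegelGen hc, ← adStar_neg, ← adStar_neg,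
    kks_adStar, trace_mul_symBracket', trace_mul_comm, Submodule.coe_neg, Matrix.neg_mul,
    trace_neg, neg_neg]

theorem omega_fderiv_M {d : ℕ} (ħ : ℝ) {x : PModel d} (hx : x ∈ P d) (u v : PModel d) :
    omega ħ (M x) (fderiv ℝ M x u) (fderiv ℝ M x v) = Omega ħ x u v := by
  rw [fderiv_M hx, fderiv_M hx, omega, Omega, M, kks_dsigma hx]

theorem mem_momentTangent_M_iff {d : ℕ} {x : PModel d} (hx : x ∈ P d) {u : Moments d} :
    u ∈ momentTangent (M x) ↔ ∃ v, fderiv ℝ M x v = u := by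
  constructor
  · rintro ⟨ξ, hξ⟩
    refine ⟨(u.1, siegelGen (-ξ) x.2), ?_⟩
    rw [fderiv_M hx, dsigma_siegelGen hx, adStar_neg, neg_neg]
    exact Prod.ext rfl hξ
  · rintro ⟨v, rfl⟩
    obtain ⟨ξ, hξ⟩ := exists_siegelGen_eq (c := x.2) hx v.2
    refine ⟨-ξ, ?_⟩
    change adStar (-ξ) (sigma x.2) = _
    rw [fderiv_M hx, ← hξ, dsigma_siegelGen hx, adStar_neg]

/-! ### The momentum map -/

theorem OmegaR_JJ_mulVec {d : ℕ} (g v : PhaseSpace d) : OmegaR (JJ d *ᵥ g) v = g ⬝ᵥ v := by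
  rw [OmegaR, dotProduct_mulVec, ← mulVec_transpose, mulVec_mulVec, JJ_transpose_mul, one_mulVec]

/-- The pairing as a continuous linear form in its first argument. -/
def pairingL {d : ℕ} (ħ : ℝ) (a : PhaseSpace d × Sym2 d) : Moments d →L[ℝ] ℝ :=
  LinearMap.toContinuousLinearMap
    { toFun := fun w => pairing ħ w a
      map_add' := fun w w' => by
        simp only [pairing, Prod.fst_add, Prod.snd_add, add_dotProduct, Submodule.coe_add,
          Matrix.add_mul, trace_add]
        ring
      map_smul' := fun r w => by
        simp only [pairing, Prod.smul_fst, Prod.smul_snd, smul_dotProduct, Submodule.coe_smul,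
          Matrix.smul_mul, trace_smul, smul_eq_mul, RingHom.id_apply]
        ring }

theorem fderiv_pairing {d : ℕ} (ħ : ℝ) (a : PhaseSpace d × Sym2 d) {K : PModel d → Moments d}
    {x : PModel d} (hK : DifferentiableAt ℝ K x) (v : PModel d) :
    fderiv ℝ (fun y => pairing ħ (K y) a) x v = pairing ħ (fderiv ℝ K x v) a := by
  have h := (pairingL ħ a).hasFDerivAt.comp x hK.hasFDerivAt
  exact congrArg (fun L => L v) h.fderiv

theorem eq_zero_of_pairing {d : ℕ} {ħ : ℝ} (hħ : ħ ≠ 0) {w : Moments d}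
    (hw : ∀ a, pairing ħ w a = 0) : w = 0 := by
  have h1 := hw (w.1, 0)
  have h2 := hw (0, w.2)
  simp only [pairing, ZeroMemClass.coe_zero, trace_zero, mul_zero, sub_zero,
    dotProduct_zero, zero_sub, neg_eq_zero, mul_eq_zero, div_eq_zero_iff, hħ, false_or,
    OfNat.ofNat_ne_zero] at h1 h2
  exact Prod.ext (dotProduct_self_eq_zero.1 h1) (eq_zero_of_trace_mul_self _ h2)

theorem isMomentumMap_M {d : ℕ} (ħ : ℝ) : IsMomentumMap ħ (M (d := d)) := by
  refine ⟨fun x hx => (contDiffAt_M hx).contDiffWithinAt, fun a x v => ?_⟩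
  rw [fderiv_pairing ħ a (differentiableAt_M x.2), infGen_eq, Omega, OmegaR_JJ_mulVec,
    OmegaH_siegelGen x.2, fderiv_M x.2, pairing, dotProduct_comm, trace_mul_comm]

/-- The momentum condition fixes the pairing of dK with every a, hence dK itself since the pairing
is nondegenerate for ħ ≠ 0. On the open connected set 𝒫 equal differentials leave only a constant.
-/
theorem IsMomentumMap.exists_eq_M_add {d : ℕ} {ħ : ℝ} (hħ : ħ ≠ 0) {K : PModel d → Moments d}
    (hK : IsMomentumMap ħ K) : ∃ c : Moments d, ∀ x ∈ P d, K x = M x + c := by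
  have hKd : ∀ x ∈ P d, DifferentiableAt ℝ K x := fun x hx =>
    (hK.1.contDiffAt ((isOpen_P d).mem_nhds hx)).differentiableAt (by simp)
  have hMd : ∀ x ∈ P d, DifferentiableAt ℝ M x := fun x hx => differentiableAt_M hx
  obtain ⟨c, hc⟩ := (isOpen_P d).exists_eq_add_of_fderiv_eq (f := K) (g := M)
    (convex_P d).isPreconnected (fun x hx => (hKd x hx).differentiableWithinAt)
    (fun x hx => (hMd x hx).differentiableWithinAt) (fun x hx => by
      refine ContinuousLinearMap.ext fun v => ?_
      refine sub_eq_zero.1 (eq_zero_of_pairing hħ fun a => ?_)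
      have e : pairing ħ (fderiv ℝ K x v) a = pairing ħ (fderiv ℝ M x v) a := by
        rw [← fderiv_pairing ħ a (hKd x hx), ← fderiv_pairing ħ a (hMd x hx),
          ← hK.2 a ⟨x, hx⟩, ← (isMomentumMap_M ħ).2 a ⟨x, hx⟩]
      exact ((pairingL ħ a).map_sub _ _).trans (sub_eq_zero.2 e))
  exact ⟨c, hc⟩

/-! ### Hamiltonian vector fields of collective Hamiltonians -/

theorem fderiv_moments_apply {d : ℕ} (f : Moments d → ℝ) (w v : Moments d) :
    fderiv ℝ f w v = dz f w ⬝ᵥ v.1 + trace ((dSigma f w).1 * v.2.1) := by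
  have hv : v = (v.1, 0) + (0, v.2) := by ext <;> simp
  have hs : (v.1, (0 : Sym2 d)) = ∑ i, v.1 i • ((Pi.single i 1, 0) : Moments d) := by
    refine Prod.ext ?_ ?_
    · rw [Prod.fst_sum]
      ext j
      simp [Finset.sum_apply, Pi.single_apply]
    · rw [Prod.snd_sum]
      simp
  have e1 : fderiv ℝ f w (v.1, 0) = dz f w ⬝ᵥ v.1 := by
    rw [hs, map_sum]
    simp only [map_smul, smul_eq_mul, dotProduct, dz]
    exact Finset.sum_congr rfl fun i _ => mul_comm _ _
  have e2 : fderiv ℝ f w (0, v.2) = trace ((dSigma f w).1 * v.2.1) :=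
    (trace_symGrad_mul ((fderiv ℝ f w).toLinearMap ∘ₗ
      LinearMap.inr ℝ (PhaseSpace d) (Sym2 d)) v.2).symm
  conv_lhs => rw [hv, map_add, e1, e2]

theorem hamVec_spec {d : ℕ} {ħ : ℝ} (hħ : ħ ≠ 0) (F : PModel d → ℝ) {x : PModel d} (hx : x ∈ P d)
    (v : PModel d) : Omega ħ x (hamVec ħ F x) v = fderiv ℝ F x v :=
  Classical.epsilon_spec (existsUnique_hamVec hħ hx (fderiv ℝ F x)).exists v

theorem hamVec_eq {d : ℕ} {ħ : ℝ} (hħ : ħ ≠ 0) {F : PModel d → ℝ} {x : PModel d} (hx : x ∈ P d)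
    {X : PModel d} (hX : ∀ v, Omega ħ x X v = fderiv ℝ F x v) : hamVec ħ F x = X :=
  (existsUnique_hamVec hħ hx (fderiv ℝ F x)).unique (hamVec_spec hħ F hx) hX

theorem fderiv_comp_M {d : ℕ} {f : Moments d → ℝ} {x : PModel d} (hx : x ∈ P d)
    (hf : DifferentiableAt ℝ f (M x)) (v : PModel d) :
    fderiv ℝ (f ∘ M) x v = fderiv ℝ f (M x) (fderiv ℝ M x v) := by
  exact congrArg (fun L => L v) (fderiv_comp x hf (differentiableAt_M hx))

/-- The Hamiltonian vector field of `f ∘ M` is pushed forward by `M` to the Hamiltonian vector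
field of `f`. -/
theorem fderiv_M_hamVec {d : ℕ} {ħ : ℝ} (hħ : ħ ≠ 0) {f : Moments d → ℝ} {x : PModel d}
    (hx : x ∈ P d) (hf : DifferentiableAt ℝ f (M x)) :
    fderiv ℝ M x (hamVec ħ (f ∘ M) x) =
      (JJ d *ᵥ dz f (M x), (4 / ħ) • adStar (dSigma f (M x)) (M x).2) := by
  -- At the point x, the differential of f ∘ M agrees with that of ⟨M, a⟩ for a = (∂f/∂z, -(4/ħ)
  -- δf/δΣ), the factor compensating the -ħ/4 of the pairing. The Hamiltonian vector is therefore
  -- the generator of a.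
  have h : hamVec ħ (f ∘ M) x =
      (JJ d *ᵥ dz f (M x), siegelGen (-((4 / ħ) • dSigma f (M x))) x.2) := by
    refine hamVec_eq hħ hx fun v => ?_
    rw [fderiv_comp_M hx hf, fderiv_M hx, fderiv_moments_apply, Omega, OmegaR_JJ_mulVec,
      OmegaH_siegelGen hx, Submodule.coe_neg, Submodule.coe_smul, Matrix.neg_mul, Matrix.smul_mul,
      trace_neg, trace_smul, smul_eq_mul]
    field_simp
    ring
  rw [h, fderiv_M hx, dsigma_siegelGen hx, adStar_neg, neg_neg, adStar_smul]
  rfl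

theorem dotProduct_JJ_mulVec {d : ℕ} (u v : PhaseSpace d) :
    u ⬝ᵥ (JJ d *ᵥ v) = ∑ i, (u (Sum.inl i) * v (Sum.inr i) - v (Sum.inl i) * u (Sum.inr i)) := by
  simp only [JJ, dotProduct, fromBlocks_mulVec, Fintype.sum_sum_type, Sum.elim_inl, Sum.elim_inr,
    zero_mulVec, one_mulVec, neg_mulVec, zero_add, add_zero, Pi.neg_apply, Function.comp_apply,
    Finset.sum_sub_distrib, mul_neg, Finset.sum_neg_distrib]
  rw [sub_eq_add_neg]
  congr 2
  exact Finset.sum_congr rfl fun i _ => mul_comm _ _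

/-- Since Ω(X_F, X_G) = dF(X_G), only the field of g ∘ M has to be pushed forward; f enters through
its differential at M(x). -/
theorem poissonP_comp_M {d : ℕ} {ħ : ℝ} (hħ : ħ ≠ 0) {f g : Moments d → ℝ} {x : PModel d}
    (hx : x ∈ P d) (hf : DifferentiableAt ℝ f (M x)) (hg : DifferentiableAt ℝ g (M x)) :
    poissonP ħ (f ∘ M) (g ∘ M) x = poissonMoments ħ f g (M x) := by
  rw [poissonP, hamVec_spec hħ _ hx, fderiv_comp_M hx hf, fderiv_M_hamVec hħ hx hg,
    fderiv_moments_apply, dotProduct_JJ_mulVec, poissonMoments, poissonR, trace_mul_symBracket',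
    Submodule.coe_smul, Matrix.mul_smul, trace_smul, smul_eq_mul, trace_mul_comm (dSigma f (M x)).1]
  ring

/-- The tangent space of ℝ^{2d} × 𝒪 at M(x) is the image of TM and ω pulls back to Ω, so existence
and uniqueness of Hamiltonian vectors are inherited from 𝒫. -/
theorem isHamVecMoments_M_iff {d : ℕ} {ħ : ℝ} (hħ : ħ ≠ 0) {f : Moments d → ℝ} {x : PModel d}
    (hx : x ∈ P d) (hf : DifferentiableAt ℝ f (M x)) (Y : Moments d) :
    IsHamVecMoments ħ f (M x) Y ↔ Y = fderiv ℝ M x (hamVec ħ (f ∘ M) x) := by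
  constructor
  · rintro ⟨hY, h⟩
    obtain ⟨X, rfl⟩ := (mem_momentTangent_M_iff hx).1 hY
    congr 1
    refine (hamVec_eq hħ hx fun v => ?_).symm
    rw [← omega_fderiv_M ħ hx, h _ ((mem_momentTangent_M_iff hx).2 ⟨v, rfl⟩), fderiv_comp_M hx hf]
  · rintro rfl
    refine ⟨(mem_momentTangent_M_iff hx).2 ⟨_, rfl⟩, fun u hu => ?_⟩
    obtain ⟨v, rfl⟩ := (mem_momentTangent_M_iff hx).1 hu
    rw [omega_fderiv_M ħ hx, hamVec_spec hħ _ hx, fderiv_comp_M hx hf]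

/-! ### The Hamiltonians -/

theorem contDiff_pderiv {ι : Type} [Fintype ι] [DecidableEq ι] {f : (ι → ℝ) → ℝ}
    {r s : WithTop ℕ∞} (hf : ContDiff ℝ r f) (hs : s + 1 ≤ r) (i : ι) :
    ContDiff ℝ s (pderiv f i) :=
  (hf.fderiv_right hs).clm_apply contDiff_const

theorem contDiff_hessian_apply {ι : Type} [Fintype ι] [DecidableEq ι] {f : (ι → ℝ) → ℝ}
    (hf : ContDiff ℝ 3 f) (i j : ι) : ContDiff ℝ 1 (fun x => hessian f x i j) :=
  contDiff_pderiv (contDiff_pderiv (s := 2) hf (by norm_num) j) (by norm_num) i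

theorem hessian_transpose {ι : Type} [Fintype ι] [DecidableEq ι] {f : (ι → ℝ) → ℝ}
    (hf : ContDiff ℝ 2 f) (x : ι → ℝ) : (hessian f x)ᵀ = hessian f x := by
  have hd : DifferentiableAt ℝ (fderiv ℝ f) x :=
    (hf.fderiv_right (m := 1) (by norm_num)).differentiable (by simp) x
  have key : ∀ i j, hessian f x i j = fderiv ℝ (fderiv ℝ f) x (Pi.single i 1) (Pi.single j 1) := by
    intro i j
    have h := hd.hasFDerivAt.clm_apply (hasFDerivAt_const (Pi.single j (1 : ℝ) : ι → ℝ) x)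
    change fderiv ℝ (fun y => fderiv ℝ f y (Pi.single j 1)) x (Pi.single i 1) = _
    rw [h.fderiv]
    simp
  ext i j
  rw [transpose_apply, key, key]
  exact (hf.contDiffAt.isSymmSndFDerivAt (by simp)) _ _

theorem fderiv_comp_inl {d : ℕ} {g : (Fin d → ℝ) → ℝ} {z : PhaseSpace d}
    (hg : DifferentiableAt ℝ g (z ∘ Sum.inl)) (u : PhaseSpace d) :
    fderiv ℝ (fun y : PhaseSpace d => g (y ∘ Sum.inl)) z u =
      fderiv ℝ g (z ∘ Sum.inl) (u ∘ Sum.inl) := by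
  have hl : HasFDerivAt (fun y : PhaseSpace d => y ∘ Sum.inl)
      (ContinuousLinearMap.pi fun i => ContinuousLinearMap.proj (Sum.inl i)) z :=
    (ContinuousLinearMap.pi fun i : Fin d =>
      (ContinuousLinearMap.proj (Sum.inl i) : PhaseSpace d →L[ℝ] ℝ)).hasFDerivAt
  exact congrArg (fun L => L u) (hg.hasFDerivAt.comp z hl).fderiv

theorem differentiable_comp_inl {d : ℕ} {g : (Fin d → ℝ) → ℝ} (hg : Differentiable ℝ g) :
    Differentiable ℝ (fun y : PhaseSpace d => g (y ∘ Sum.inl)) :=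
  hg.comp (differentiable_pi.2 fun _ => differentiable_apply _)

theorem hasFDerivAt_kinetic {d : ℕ} (m : ℝ) (z : PhaseSpace d) :
    HasFDerivAt (fun y : PhaseSpace d => (y ∘ Sum.inr) ⬝ᵥ (y ∘ Sum.inr) / (2 * m))
      (∑ i : Fin d, (z (Sum.inr i) / m) •
        (ContinuousLinearMap.proj (Sum.inr i) : PhaseSpace d →L[ℝ] ℝ)) z := by
  have h : HasFDerivAt (fun y : PhaseSpace d => ∑ i : Fin d, y (Sum.inr i) * y (Sum.inr i)) _ z :=
    HasFDerivAt.fun_sum fun i _ => (hasFDerivAt_apply (𝕜 := ℝ) (Sum.inr i) z).mul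
      (hasFDerivAt_apply (Sum.inr i) z)
  have h' := h.mul_const (2 * m)⁻¹
  simp only [dotProduct, div_eq_mul_inv, Function.comp_apply]
  refine h'.congr_fderiv ?_
  ext u
  simp only [_root_.smul_apply, _root_.sum_apply, _root_.add_apply,
    ContinuousLinearMap.proj_apply, smul_eq_mul, Finset.mul_sum,
    mul_inv]
  exact Finset.sum_congr rfl fun i _ => by ring

/-- The potential W is arbitrary because the formula serves both V and the corrected potential V +
(ħ/4) tr(Σ₁₁ D²V). -/
theorem fderiv_Hcl {d : ℕ} (m : ℝ) {W : (Fin d → ℝ) → ℝ} (hW : Differentiable ℝ W)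
    (z u : PhaseSpace d) :
    fderiv ℝ (Hcl m W) z u =
      (∑ i, z (Sum.inr i) / m * u (Sum.inr i)) + fderiv ℝ W (z ∘ Sum.inl) (u ∘ Sum.inl) := by
  have h := (hasFDerivAt_kinetic m z).add (differentiable_comp_inl hW z).hasFDerivAt
  have e : fderiv ℝ (Hcl m W) z = _ := h.fderiv
  rw [e, _root_.add_apply, fderiv_comp_inl (hW _)]
  simp

theorem differentiable_Hcl {d : ℕ} (m : ℝ) {W : (Fin d → ℝ) → ℝ} (hW : Differentiable ℝ W) :
    Differentiable ℝ (Hcl m W) := fun z =>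
  ((hasFDerivAt_kinetic m z).differentiableAt.add (differentiable_comp_inl hW z) :)

theorem single_inl_comp_inl {d : ℕ} (i : Fin d) :
    (Pi.single (Sum.inl i) 1 : PhaseSpace d) ∘ Sum.inl = Pi.single i 1 := by
  ext j
  simp [Pi.single_apply]

theorem single_inr_comp_inl {d : ℕ} (i : Fin d) :
    (Pi.single (Sum.inr i) 1 : PhaseSpace d) ∘ Sum.inl = 0 := by
  ext j
  simp

theorem pderiv_Hcl_inl {d : ℕ} (m : ℝ) {W : (Fin d → ℝ) → ℝ} (hW : Differentiable ℝ W)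
    (z : PhaseSpace d) (i : Fin d) :
    pderiv (Hcl m W) (Sum.inl i) z = pderiv W i (z ∘ Sum.inl) := by
  rw [pderiv, fderiv_Hcl m hW, single_inl_comp_inl]
  simp [pderiv]

theorem pderiv_Hcl_inr {d : ℕ} (m : ℝ) {W : (Fin d → ℝ) → ℝ} (hW : Differentiable ℝ W)
    (z : PhaseSpace d) (i : Fin d) : pderiv (Hcl m W) (Sum.inr i) z = z (Sum.inr i) / m := by
  rw [pderiv, fderiv_Hcl m hW, single_inr_comp_inl]
  simp [Pi.single_apply]

theorem hessian_Hcl {d : ℕ} (m : ℝ) {V : (Fin d → ℝ) → ℝ} (hV : ContDiff ℝ 2 V)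
    (z : PhaseSpace d) :
    hessian (Hcl m V) z = fromBlocks (hessian V (z ∘ Sum.inl)) 0 0 ((1 / m) • 1) := by
  have hV1 : Differentiable ℝ V := hV.differentiable (by simp)
  have hp : ∀ j, Differentiable ℝ (pderiv V j) := fun j =>
    (contDiff_pderiv (s := 1) hV (by norm_num) j).differentiable (by simp)
  have e1 : ∀ j, pderiv (Hcl m V) (Sum.inl j) = fun y => pderiv V j (y ∘ Sum.inl) := fun j =>
    funext fun y => pderiv_Hcl_inl m hV1 y j
  have e2 : ∀ j, pderiv (Hcl m V) (Sum.inr j) = fun y => y (Sum.inr j) / m := fun j =>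
    funext fun y => pderiv_Hcl_inr m hV1 y j
  have e3 : ∀ j u, fderiv ℝ (fun y : PhaseSpace d => y (Sum.inr j) / m) z u =
      u (Sum.inr j) / m := by
    intro j u
    have h := (hasFDerivAt_apply (𝕜 := ℝ) (Sum.inr j : Fin d ⊕ Fin d) z).mul_const m⁻¹
    simp only [div_eq_mul_inv]
    rw [h.fderiv]
    simp [mul_comm]
  ext (i | i) (j | j)
  · change pderiv (pderiv (Hcl m V) (Sum.inl j)) (Sum.inl i) z = _
    rw [e1, pderiv, fderiv_comp_inl (hp j _), single_inl_comp_inl]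
    rfl
  · change pderiv (pderiv (Hcl m V) (Sum.inr j)) (Sum.inl i) z = _
    rw [e2, pderiv, e3]
    simp
  · change pderiv (pderiv (Hcl m V) (Sum.inl j)) (Sum.inr i) z = _
    rw [e1, pderiv, fderiv_comp_inl (hp j _), single_inr_comp_inl]
    simp
  · change pderiv (pderiv (Hcl m V) (Sum.inr j)) (Sum.inr i) z = _
    rw [e2, pderiv, e3]
    simp [Pi.single_apply, Matrix.one_apply, eq_comm, div_eq_mul_inv]

theorem h_eq {d : ℕ} (ħ m : ℝ) {V : (Fin d → ℝ) → ℝ} (hV : ContDiff ℝ 2 V) (w : Moments d) :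
    h ħ m V w = Hcl m V w.1 + ħ / 4 * trace (w.2.1 * hessian (Hcl m V) w.1) := by
  rw [hessian_Hcl m hV]
  conv_rhs => rw [← fromBlocks_toBlocks w.2.1]
  rw [fromBlocks_multiply, trace_fromBlocks_add]
  simp only [h, Hcl, Matrix.mul_zero, add_zero, zero_add, Matrix.mul_smul, Matrix.mul_one,
    trace_add]
  ring

theorem differentiable_trace_mul_hessian {d : ℕ} {V : (Fin d → ℝ) → ℝ} (hV : ContDiff ℝ 3 V)
    (A : Matrix (Fin d) (Fin d) ℝ) : Differentiable ℝ fun q => trace (A * hessian V q) := by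
  simp only [trace, diag, Matrix.mul_apply]
  exact Differentiable.fun_sum fun i _ => Differentiable.fun_sum fun j _ =>
    ((contDiff_hessian_apply hV j i).differentiable (by simp)).const_mul _

/-- This is where three derivatives of V are used: h contains D²V, which must be C¹. -/
theorem differentiable_h {d : ℕ} (ħ m : ℝ) {V : (Fin d → ℝ) → ℝ} (hV : ContDiff ℝ 3 V) :
    Differentiable ℝ (h ħ m V) := by
  have hV1 : Differentiable ℝ V := hV.differentiable (by simp)
  have hS : ∀ i j, Differentiable ℝ fun w : Moments d => w.2.1 i j := by
    intro i j w
    have h1 : ContDiffAt ℝ 1 (fun w : Moments d => w.2.1) w :=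
      ((contDiff_sym_coe (n := Fin d ⊕ Fin d)).comp contDiff_snd).contDiffAt
    exact (contDiffAt_matrix.1 h1 i j).differentiableAt (by simp)
  have hH : ∀ i j, Differentiable ℝ fun w : Moments d => hessian V (w.1 ∘ Sum.inl) i j :=
    fun i j => (differentiable_comp_inl
      ((contDiff_hessian_apply hV i j).differentiable (by simp))).comp differentiable_fst
  have e : h ħ m V = fun w => Hcl m V w.1 + ħ / 4 *
      ∑ i, (1 / m * w.2.1 (Sum.inr i) (Sum.inr i) +
        ∑ j, w.2.1 (Sum.inl i) (Sum.inl j) * hessian V (w.1 ∘ Sum.inl) j i) := by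
    funext w
    simp only [h, Hcl, trace, diag, Matrix.add_apply, Matrix.mul_apply, Matrix.smul_apply,
      smul_eq_mul]
    rfl
  rw [e]
  exact ((differentiable_Hcl m hV1).comp differentiable_fst).add
    ((Differentiable.fun_sum fun i _ => ((hS _ _).const_mul _).add
      (Differentiable.fun_sum fun j _ => (hS _ _).mul (hH _ _))).const_mul _)

/-- H is collective: by cyclicity tr(ℬ⁻¹(𝒜² + ℬ²)) = tr(𝒜ℬ⁻¹𝒜 + ℬ), the trace of the lower right
block of σ. -/
theorem H_eq_h_M {d : ℕ} (ħ m : ℝ) (V : (Fin d → ℝ) → ℝ) {x : PModel d} (hx : x ∈ P d) :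
    H ħ m V x = h ħ m V (M x) := by
  have hu : IsUnit (x.2.2.1).det := isUnit_det_of_mem_siegel hx
  simp only [H, h, M, sigma, toBlocks_fromBlocks₁₁, toBlocks_fromBlocks₂₂, pow_two, Matrix.mul_add,
    Matrix.mul_smul, trace_add, trace_smul, smul_add, nonsing_inv_mul_cancel_left _ _ hu]
  rw [← Matrix.mul_assoc, trace_mul_comm ((x.2.2.1)⁻¹ * x.2.1.1), Matrix.mul_assoc]

/-- The two functions agree only on 𝒫, but 𝒫 is open, so their differentials at x coincide. -/
theorem hamVec_H {d : ℕ} (ħ m : ℝ) (V : (Fin d → ℝ) → ℝ) {x : PModel d} (hx : x ∈ P d) :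
    hamVec ħ (H ħ m V) x = hamVec ħ (h ħ m V ∘ M) x := by
  have e : H ħ m V =ᶠ[nhds x] h ħ m V ∘ M := by
    filter_upwards [(isOpen_P d).mem_nhds hx] with y hy using H_eq_h_M ħ m V hy
  rw [hamVec, hamVec, e.fderiv_eq]

/-- For frozen Σ, h is a classical Hamiltonian with the corrected potential, plus the constant (ħ/4)
tr(Σ₂₂)/m. -/
theorem dz_h {d : ℕ} (ħ m : ℝ) {V : (Fin d → ℝ) → ℝ} (hV : ContDiff ℝ 3 V) (w : Moments d)
    (i : Fin d ⊕ Fin d) :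
    dz (h ħ m V) w i = pderiv (Hcl m fun q => V q + ħ / 4 *
      trace (w.2.1.toBlocks₁₁ * hessian V q)) i w.1 := by
  set W : (Fin d → ℝ) → ℝ := fun q => V q + ħ / 4 * trace (w.2.1.toBlocks₁₁ * hessian V q)
  have hW : Differentiable ℝ W := (hV.differentiable (by simp)).add
    ((differentiable_trace_mul_hessian hV _).const_mul _)
  have h1 := (differentiable_h ħ m hV (w.1, w.2)).hasFDerivAt.comp w.1
    (hasFDerivAt_prodMk_left (𝕜 := ℝ) w.1 w.2)
  have h2 := (differentiable_Hcl m hW w.1).hasFDerivAt.add_const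
    (ħ / 4 * trace ((1 / m) • w.2.1.toBlocks₂₂))
  have e : (h ħ m V ∘ fun z => (z, w.2)) =
      fun z => Hcl m W z + ħ / 4 * trace ((1 / m) • w.2.1.toBlocks₂₂) := by
    funext z
    simp only [h, Hcl, W, Function.comp_apply, trace_add]
    ring
  rw [e] at h1
  exact congrArg (fun L => L (Pi.single i 1)) (h1.unique h2)

theorem Sym.eq_of_trace_mul {n : Type} [Fintype n] {A B : Sym n}
    (h : ∀ η : Sym n, trace (A.1 * η.1) = trace (B.1 * η.1)) : A = B := by
  rw [← sub_eq_zero]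
  apply eq_zero_of_trace_mul_self
  nth_rewrite 1 [Submodule.coe_sub]
  rw [Matrix.sub_mul, trace_sub, h, sub_self]

/-- h is affine in Σ with slope (ħ/4) D²H_cl, and this matrix is symmetric, so it is itself the
gradient for the trace pairing on symmetric matrices. -/
theorem dSigma_h {d : ℕ} (ħ m : ℝ) {V : (Fin d → ℝ) → ℝ} (hV : ContDiff ℝ 3 V) (w : Moments d) :
    (dSigma (h ħ m V) w).1 = (ħ / 4) • hessian (Hcl m V) w.1 := by
  have hV2 : ContDiff ℝ 2 V := hV.of_le (by norm_num)
  have hsymm : (hessian (Hcl m V) w.1)ᵀ = hessian (Hcl m V) w.1 := by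
    rw [hessian_Hcl m hV2, fromBlocks_transpose, hessian_transpose hV2]
    simp
  let D : Sym2 d := ⟨(ħ / 4) • hessian (Hcl m V) w.1, by
    change ((ħ / 4) • hessian (Hcl m V) w.1)ᵀ = _
    rw [transpose_smul, hsymm]⟩
  suffices hD : dSigma (h ħ m V) w = D from congrArg Subtype.val hD
  refine Sym.eq_of_trace_mul fun η => ?_
  have hl : HasDerivAt (fun t : ℝ => ((w.1, w.2 + t • η) : Moments d)) (0, η) 0 := by
    refine (hasDerivAt_const (0 : ℝ) w.1).prodMk ?_
    have := ((hasDerivAt_id (0 : ℝ)).smul_const η).const_add w.2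
    rwa [one_smul] at this
  have e0 : ((w.1, w.2 + (0 : ℝ) • η) : Moments d) = w := by simp
  have h1 := HasFDerivAt.comp_hasDerivAt_of_eq (0 : ℝ) (differentiable_h ħ m hV w).hasFDerivAt
    hl e0.symm
  have e : (h ħ m V ∘ fun t : ℝ => ((w.1, w.2 + t • η) : Moments d)) =
      fun t : ℝ => h ħ m V w + t * trace (D.1 * η.1) := by
    funext t
    simp only [Function.comp_apply, h_eq ħ m hV2, D, Submodule.coe_add, Submodule.coe_smul,
      Matrix.add_mul, Matrix.smul_mul, trace_add, trace_smul, smul_eq_mul,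
      trace_mul_comm (hessian (Hcl m V) w.1)]
    ring
  have h2 : HasDerivAt (fun t : ℝ => h ħ m V w + t * trace (D.1 * η.1)) (trace (D.1 * η.1)) 0 := by
    have := ((hasDerivAt_id (0 : ℝ)).mul_const (trace (D.1 * η.1))).const_add (h ħ m V w)
    rwa [one_mul] at this
  rw [e] at h1
  have h3 := (fderiv_moments_apply (h ħ m V) w (0, η)).symm.trans (h1.unique h2)
  rwa [dotProduct_zero, zero_add] at h3

theorem JJ_mulVec_inl {d : ℕ} (g : PhaseSpace d) (i : Fin d) :
    (JJ d *ᵥ g) (Sum.inl i) = g (Sum.inr i) := by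
  simp [JJ, fromBlocks_mulVec]

theorem JJ_mulVec_inr {d : ℕ} (g : PhaseSpace d) (i : Fin d) :
    (JJ d *ᵥ g) (Sum.inr i) = -g (Sum.inl i) := by
  simp [JJ, fromBlocks_mulVec, neg_mulVec]

theorem poissonR_coord {d : ℕ} (f : Moments d → ℝ) (w : Moments d) (i : Fin d ⊕ Fin d) :
    poissonR (fun w' => w'.1 i) f w = (JJ d *ᵥ dz f w) i := by
  have e : dz (fun w' : Moments d => w'.1 i) w = Pi.single i 1 := by
    funext j
    have h := (hasFDerivAt_apply (𝕜 := ℝ) i w.1).comp w hasFDerivAt_fst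
    rw [dz]
    refine (congrArg (fun L => L ((Pi.single j 1, 0) : Moments d)) h.fderiv).trans ?_
    simp [Pi.single_apply, eq_comm]
  rw [poissonR, e, ← dotProduct_JJ_mulVec, single_one_dotProduct]

end GWP

end

theorem proposition5p1 (d : ℕ) (ħ m : ℝ) (hħ : 0 < ħ) (hm : 0 < m)
    (V : (Fin d → ℝ) → ℝ) (hV : ContDiff ℝ 3 V) :
    -- `Ψ` is an action of `G` on `𝒫`, and its infinitesimal generators exist
    ((∀ x : GWP.P d, GWP.Psi 1 x = x) ∧
      (∀ (g g' : GWP.G d) (x : GWP.P d), GWP.Psi (g * g') x = GWP.Psi g (GWP.Psi g' x)) ∧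
      (∀ (a : GWP.PhaseSpace d × GWP.Sym2 d) (x : GWP.P d),
        DifferentiableAt ℝ (GWP.orbitCurve a x) 0)) ∧
    -- (i) `M` is the momentum map (unique up to an additive constant), and it is equivariant
    (GWP.IsMomentumMap ħ (GWP.M (d := d)) ∧
      (∀ K : GWP.PModel d → GWP.Moments d, GWP.IsMomentumMap ħ K →
        ∃ c : GWP.Moments d, ∀ x ∈ GWP.P d, K x = GWP.M x + c) ∧
      (∀ (g : GWP.G d) (x : GWP.P d),
        GWP.M (GWP.Psi g x).1 = GWP.momentAct g (GWP.M x.1))) ∧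
    -- (ii) `M` is Poisson
    (∀ f g : GWP.Moments d → ℝ, ContDiff ℝ ∞ f → ContDiff ℝ ∞ g → ∀ x ∈ GWP.P d,
      GWP.poissonP ħ (f ∘ GWP.M) (g ∘ GWP.M) x = GWP.poissonMoments ħ f g (GWP.M x)) ∧
    -- (iii) `M` maps `𝒫` to `ℝ^{2d} × 𝒪` for the orbit `𝒪` that meets its image, and `M^* ω = Ω`
    (∀ μ : GWP.Sym2 d, (∃ c ∈ GWP.siegel d, GWP.sigma c ∈ GWP.coadjointOrbit μ) →
      ∀ x ∈ GWP.P d, (GWP.M x).2 ∈ GWP.coadjointOrbit μ ∧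
        (∀ u, fderiv ℝ GWP.M x u ∈ GWP.momentTangent (GWP.M x)) ∧
        ∀ u v, GWP.omega ħ (GWP.M x) (fderiv ℝ GWP.M x u) (fderiv ℝ GWP.M x v) =
          GWP.Omega ħ x u v) ∧
    -- (iv) the pushed-forward dynamics
    ((∀ w : GWP.Moments d, GWP.h ħ m V w =
        GWP.Hcl m V w.1 - ħ / 4 * -Matrix.trace (w.2.1 * GWP.hessian (GWP.Hcl m V) w.1)) ∧
      ∀ c ∈ GWP.siegel d,
        -- the equation `X_h ∘ M = TM ∘ X_H` defines exactly one field `X_h` on `ℝ^{2d} × 𝒪_Σ`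
        (∃! X : {w : GWP.Moments d // w.2 ∈ GWP.coadjointOrbit (GWP.sigma c)} → GWP.Moments d,
          ∀ x ∈ GWP.P d, ∀ w, w.1 = GWP.M x →
            X w = fderiv ℝ GWP.M x (GWP.hamVec ħ (GWP.H ħ m V) x)) ∧
        ∀ X : {w : GWP.Moments d // w.2 ∈ GWP.coadjointOrbit (GWP.sigma c)} → GWP.Moments d,
          (∀ x ∈ GWP.P d, ∀ w, w.1 = GWP.M x →
            X w = fderiv ℝ GWP.M x (GWP.hamVec ħ (GWP.H ħ m V) x)) →
          ∀ w,
            -- it is the Hamiltonian vector field of `h` with respect to `ω`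
            (∀ Y, GWP.IsHamVecMoments ħ (GWP.h ħ m V) w.1 Y ↔ Y = X w) ∧
            -- it is `ż = {z, h}`, `Σ̇ = (4/ħ)(𝕁 (δh/δΣ) Σ - Σ (δh/δΣ) 𝕁)`
            (∀ i, (X w).1 i = GWP.poissonR (fun w' => w'.1 i) (GWP.h ħ m V) w.1) ∧
            (X w).2 = (4 / ħ) • GWP.adStar (GWP.dSigma (GWP.h ħ m V) w.1) w.1.2 ∧
            -- and concretely
            (∀ i, (X w).1 (Sum.inl i) = w.1.1 (Sum.inr i) / m) ∧
            (∀ i, (X w).1 (Sum.inr i) = -GWP.pderiv (fun q => V q + ħ / 4 *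
              Matrix.trace (w.1.2.1.toBlocks₁₁ * GWP.hessian V q)) i (w.1.1 ∘ Sum.inl)) ∧
            (X w).2.1 = GWP.JJ d * GWP.hessian (GWP.Hcl m V) w.1.1 * w.1.2.1 -
              w.1.2.1 * GWP.hessian (GWP.Hcl m V) w.1.1 * GWP.JJ d) := by
  have hħ0 : ħ ≠ 0 := hħ.ne'
  have hV2 : ContDiff ℝ 2 V := hV.of_le (by norm_num)
  have hV1 : Differentiable ℝ V := hV.differentiable (by simp)
  have hh := GWP.differentiable_h ħ m hV
  refine ⟨⟨GWP.Psi_one, GWP.Psi_mul,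
      fun a x => (GWP.hasDerivAt_orbitCurve a x).differentiableAt⟩,
    ⟨GWP.isMomentumMap_M ħ, fun K hK => hK.exists_eq_M_add hħ0, GWP.M_Psi⟩,
    fun f g hf hg x hx => GWP.poissonP_comp_M hħ0 hx (hf.differentiable (by simp) _)
      (hg.differentiable (by simp) _),
    fun μ ⟨c, hc, hcμ⟩ x hx => ⟨GWP.sigma_mem_coadjointOrbit hc hx hcμ,
      fun u => (GWP.mem_momentTangent_M_iff hx).2 ⟨u, rfl⟩, GWP.omega_fderiv_M ħ hx⟩,
    fun w => by rw [GWP.h_eq ħ m hV2]; ring, fun c hc => ⟨?_, fun X hX w => ?_⟩⟩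
  -- The field is defined by choosing a preimage of w under M; injectivity of M on 𝒫 makes the
  -- choice immaterial, and surjectivity gives uniqueness.
  · have hex := fun w : {w : GWP.Moments d // w.2 ∈ GWP.coadjointOrbit (GWP.sigma c)} =>
      GWP.exists_M_eq hc w.2
    choose x hx hxM using hex
    refine ⟨fun w => fderiv ℝ GWP.M (x w) (GWP.hamVec ħ (GWP.H ħ m V) (x w)), ?_, ?_⟩
    · intro y hy w hw
      have : x w = y := GWP.M_injOn (hx w) hy ((hxM w).trans hw)
      simp only [this]
    · intro X hX
      funext w
      exact hX (x w) (hx w) w (hxM w).symm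
  -- Every point of ℝ^{2d} × 𝒪 is some M(x), so each claim about X at w becomes a claim about the
  -- pushed-forward collective field at x.
  · obtain ⟨x, hx, hxM⟩ := GWP.exists_M_eq hc w.2
    have hXw := hX x hx w hxM.symm
    rw [GWP.hamVec_H ħ m V hx] at hXw
    have hX' := hXw.trans (GWP.fderiv_M_hamVec hħ0 hx (hh _))
    rw [hxM] at hX'
    have hW : Differentiable ℝ fun q => V q + ħ / 4 *
        Matrix.trace (w.1.2.1.toBlocks₁₁ * GWP.hessian V q) :=
      hV1.add ((GWP.differentiable_trace_mul_hessian hV _).const_mul _)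
    refine ⟨fun Y => ?_, fun i => ?_, ?_, fun i => ?_, fun i => ?_, ?_⟩
    · rw [hXw, ← hxM]
      exact GWP.isHamVecMoments_M_iff hħ0 hx (hh _) Y
    · rw [hX', GWP.poissonR_coord]
    · rw [hX']
    · refine (congrFun (congrArg Prod.fst hX') _).trans ((GWP.JJ_mulVec_inl _ _).trans ?_)
      rw [GWP.dz_h ħ m hV, GWP.pderiv_Hcl_inr m hW]
    · refine (congrFun (congrArg Prod.fst hX') _).trans ((GWP.JJ_mulVec_inr _ _).trans ?_)
      rw [GWP.dz_h ħ m hV, GWP.pderiv_Hcl_inl m hW]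
    · rw [hX']
      simp only [GWP.adStar, Submodule.coe_smul, GWP.dSigma_h ħ m hV, Matrix.mul_smul,
        Matrix.smul_mul, ← smul_sub, smul_smul]
      rw [div_mul_div_cancel₀ hħ0, div_self (by norm_num), one_smul]
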